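/- Let $f:\mathbb{R}^n\to\mathbb{R}\cup\{+\infty\}$ be proper, convex and lower semicontinuous, let $g:\mathbb{R}^n\to\mathbb{R}$ be Fréchet differentiable with $\beta$-Lipschitz continuous gradient ($\beta\ge 0$), and suppose that $f+g$ is bounded from below. Let $\gamma,\lambda>0$, and put $L:=\min(L_1,L_2)$, where $$L_1=\sqrt{\max\big((\gamma+1)^2,(\gamma+2)((1+\lambda\beta)^2+1)\big)},\qquad L_2=\sqrt{\max\big((\gamma+1)^2+\gamma\lambda\beta,(2+\lambda\beta)^2+\gamma(2+\lambda\beta)\big)}.$$ Assume that $$A=-\frac12\frac{\gamma}{\lambda}+\frac{\beta}{2}(L^2+2\gamma^2+1)<0,\qquad B=-\frac1{2L^2}\frac{\gamma}{\lambda}+\frac{\beta}{2}(L^2+\gamma^2+1)<0,\qquad C=-\frac{2L^2+1}{(L^2+1)^2}\gamma^2+3\beta\gamma\lambda-1<0.$$ For $u_0,v_0\in\mathbb{R}^n$, let $x\in C^2([0,+\infty),\mathbb{R}^n)$ be the unique global solution of $$\ddot x(t)+\gamma\dot x(t)+x(t)=\operatorname{prox}_{\lambda f}\big(x(t)-\lambda\nabla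 g(x(t))\big),\qquad x(0)=u_0,\ \dot x(0)=v_0,$$ where $\operatorname{prox}_{\lambda f}(z)=\operatorname{argmin}_{y}\{f(y)+\frac1{2\lambda}\|y-z\|^2\}$. For a function $h$ with values in $\mathbb{R}\cup\{+\infty\}$ let $\partial h$ be its limiting (Mordukhovich) subdifferential and $\operatorname{crit}h=\{z:0\in\partial h(z)\}$, and let $$H(u,v,w)=(f+g)(u)+\frac1{2\lambda}\|u-v\|^2-\frac{C}{2\lambda}\|w\|^2,\qquad (u,v,w)\in\mathbb{R}^n\times\mathbb{R}^n\times\mathbb{R}^n .$$ Suppose that $x$ is bounded, that $\overline x\in\operatorname{crit}(f+g)$ satisfies $\lim_{t\to+\infty}x(t)=\overline x$, and that $H$ has the Łojasiewicz property at $(\overline x,\overline x,0)\in\operatorname{crit}H$ with exponent $\theta\in(0,1)$: there are $K,\varepsilon>0$ such that $|H(z)-H(\overline x,\overline x,0)|^\theta\le K\|z^*\|$ for all $z$ with $\|z-(\overline x,\overline x,0)\|<\varepsilon$ and all $z^*\in\partial H(z)$. Then there exist $a_1,a_2,a_3,a_4>0$ and $t_0>0$ such that for every $t\ge t_0$: (a)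 if $\theta\in(0,\frac12)$, then $x$ converges in finite time, that is, $x(t)=\overline x$; (b) if $\theta=\frac12$, then $\|x(t)-\overline x\|\le a_1e^{-a_2t}$ and $\|\dot x(t)\|\le a_1e^{-a_2t}$; (c) if $\theta\in(\frac12,1)$, then $\|x(t)-\overline x\|\le(a_3t+a_4)^{-\frac{1-\theta}{2\theta-1}}$ and $\|\dot x(t)\|\le(a_3t+a_4)^{-\frac{1-\theta}{2\theta-1}}$. -/

import Mathlib

open Set Filter Topology

noncomputable section

namespace ProxGrad

/-! Functions with values in `ℝ ∪ {+∞}` are modelled as `EReal`-valued functions that never take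
the value `⊥`. -/

/-- Convexity of an extended-real-valued function (only weights `a, b > 0` are used, so that no
product `0 * ⊤` occurs). -/
def ConvexFun {V : Type*} [AddCommGroup V] [Module ℝ V] (f : V → EReal) : Prop :=
  ∀ x y : V, ∀ a b : ℝ, 0 < a → 0 < b → a + b = 1 →
    f (a • x + b • y) ≤ (a : EReal) * f x + (b : EReal) * f y

/-- The sum `f + g` of an extended-real-valued function and a real-valued one. -/
def objective {V : Type*} (f : V → EReal) (g : V → ℝ) : V → EReal :=
  fun u => f u + (g u : EReal)

section Subdifferential

variable {V : Type*} [NormedAddCommGroup V] [InnerProductSpace ℝ V]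

/-- The Fréchet (viscosity) subdifferential of `h` at `x`; it is empty outside the domain. -/
def frechetSubdiff (h : V → EReal) (x : V) : Set V :=
  {v | h x ≠ ⊤ ∧
    0 ≤ liminf (fun y => (h y - h x - ((inner ℝ v (y - x) : ℝ) : EReal)) / ((‖y - x‖ : ℝ) : EReal))
      (𝓝[≠] x)}

/-- The limiting (Mordukhovich) subdifferential of `h` at `x`; it is empty outside the domain. -/
def limitingSubdiff (h : V → EReal) (x : V) : Set V :=
  {v | h x ≠ ⊤ ∧ ∃ u p : ℕ → V,
    Tendsto u atTop (𝓝 x) ∧ Tendsto (fun k => h (u k)) atTop (𝓝 (h x)) ∧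
    (∀ k, p k ∈ frechetSubdiff h (u k)) ∧ Tendsto p atTop (𝓝 v)}

/-- The set of (limiting-)critical points of `h`. -/
def crit (h : V → EReal) : Set V := {x | (0 : V) ∈ limitingSubdiff h x}

/-- `h` has the Łojasiewicz property at the critical point `xbar` with exponent `θ ∈ (0,1)`.
Points where the limiting subdifferential is nonempty lie in the domain of `h`, so `toReal` is only
applied to finite values. -/
def HasLojasiewiczExponentAt (h : V → EReal) (xbar : V) (θ : ℝ) : Prop :=
  xbar ∈ crit h ∧ 0 < θ ∧ θ < 1 ∧ ∃ K ε : ℝ, 0 < K ∧ 0 < ε ∧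
    ∀ x : V, ‖x - xbar‖ < ε → ∀ p ∈ limitingSubdiff h x,
      |(h x).toReal - (h xbar).toReal| ^ θ ≤ K * ‖p‖

/-- `p = prox_{lam f}(z)`, that is, `p` minimizes `y ↦ f y + ‖y - z‖² / (2 lam)`.
For `f` proper, convex and lower semicontinuous and `lam > 0` there is exactly one such `p`. -/
def IsProx (f : V → EReal) (lam : ℝ) (z p : V) : Prop :=
  ∀ y : V, f p + ((1 / (2 * lam) * ‖p - z‖ ^ 2 : ℝ) : EReal) ≤
    f y + ((1 / (2 * lam) * ‖y - z‖ ^ 2 : ℝ) : EReal)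

/-- The velocity of a curve on `[0, +∞)` (one-sided derivative at `0`). -/
def velocity (x : ℝ → V) : ℝ → V := derivWithin x (Ici 0)

/-- The acceleration of a curve on `[0, +∞)` (one-sided derivative at `0`). -/
def acceleration (x : ℝ → V) : ℝ → V := derivWithin (velocity x) (Ici 0)

/-- `x` is a global solution, twice continuously differentiable on `[0, +∞)`, of
`x'' + γ x' + x = prox_{lam f}(x - lam ∇g(x))`, `x(0) = u₀`, `x'(0) = v₀`. -/
structure IsSolution [CompleteSpace V] (f : V → EReal) (g : V → ℝ) (γ lam : ℝ) (u₀ v₀ : V)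
    (x : ℝ → V) : Prop where
  contDiffOn : ContDiffOn ℝ 2 x (Ici 0)
  prox_eq : ∀ t : ℝ, 0 ≤ t →
    IsProx f lam (x t - lam • gradient g (x t)) (acceleration x t + γ • velocity x t + x t)
  position_zero : x 0 = u₀
  velocity_zero : velocity x 0 = v₀

/-- The product `V × V × V` with its Euclidean (Hilbert) norm. -/
abbrev Triple (V : Type*) : Type _ := PiLp 2 (fun _ : Fin 3 => V)

/-- The triple `(u, v, w)`. -/
def triple (u v w : V) : Triple V := WithLp.toLp 2 ![u, v, w]

/-- The regularization
`H(u, v, w) = (f + g)(u) + ‖u - v‖² / (2 lam) - C / (2 lam) * ‖w‖²`. -/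
def regularization (f : V → EReal) (g : V → ℝ) (lam C : ℝ) : Triple V → EReal :=
  fun z => objective f g (z 0) +
    ((1 / (2 * lam) * ‖z 0 - z 1‖ ^ 2 - C / (2 * lam) * ‖z 2‖ ^ 2 : ℝ) : EReal)

end Subdifferential

/-- `L₁ = √(max ((γ+1)², (γ+2)((1+λβ)²+1)))`. -/
def constL₁ (γ lam β : ℝ) : ℝ :=
  √(max ((γ + 1) ^ 2) ((γ + 2) * ((1 + lam * β) ^ 2 + 1)))

/-- `L₂ = √(max ((γ+1)²+γλβ, (2+λβ)²+γ(2+λβ)))`. -/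
def constL₂ (γ lam β : ℝ) : ℝ :=
  √(max ((γ + 1) ^ 2 + γ * lam * β) ((2 + lam * β) ^ 2 + γ * (2 + lam * β)))

/-- `L = min (L₁, L₂)`. -/
def constL (γ lam β : ℝ) : ℝ := min (constL₁ γ lam β) (constL₂ γ lam β)

/-- `A = -(1/2)(γ/λ) + (β/2)(L² + 2γ² + 1)`. -/
def constA (γ lam β : ℝ) : ℝ :=
  -(1 / 2) * (γ / lam) + β / 2 * (constL γ lam β ^ 2 + 2 * γ ^ 2 + 1)

/-- `B = -(1/(2L²))(γ/λ) + (β/2)(L² + γ² + 1)`. -/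
def constB (γ lam β : ℝ) : ℝ :=
  -(1 / (2 * constL γ lam β ^ 2)) * (γ / lam) + β / 2 * (constL γ lam β ^ 2 + γ ^ 2 + 1)

/-- `C = -((2L²+1)/(L²+1)²)γ² + 3βγλ - 1`. -/
def constC (γ lam β : ℝ) : ℝ :=
  -((2 * constL γ lam β ^ 2 + 1) / (constL γ lam β ^ 2 + 1) ^ 2) * γ ^ 2 + 3 * β * γ * lam - 1

end ProxGrad

end

/-! Write `a`, `b` for velocity and acceleration and `y = b + γ a + x` for the proximal point. The
Lyapunov function is the regularization evaluated at `(y, y - (b + κ a), a)`, with `κ = γ L² / (L² +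
1)`. Its lower right Dini derivative is at most `A ‖a‖² + B ‖b‖²` (`energy_lowerRightDiniLE`,
resting on the algebra of `energy_rate_le`). Dini derivatives are used because `b` is merely
continuous and `f` nonsmooth: convexity gives a one-sided bound on difference quotients of `f` along
`y`, and nonexpansiveness of the prox keeps the quotients of `b` bounded.

Convergence of `x` forces `a` and `b` to vanish at infinity (`trajectory_limits`), so the energy
tends to the critical value and the evaluation points eventually enter the Łojasiewicz
neighbourhood. An explicit subgradient of the regularization has norm `O(‖a‖ + ‖b‖)` there, so the
energy gap `e` satisfies `e ^ θ ≤ K (‖a‖ + ‖b‖)` (`exists_lojasiewicz_along_trajectory`).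

Two consequences of dissipation combined with this inequality give the rates. First, `e ^ (1 - θ)`
decreases at least as fast as a multiple of `‖a‖ + ‖b‖`, hence dominates the remaining length of
both `x` and `a`. Secondly, `e' ≤ -(c / K²) e ^ (2θ)`, and comparison with explicit solutions yields
extinction, exponential or power decay according to `θ`. -/

/-! ### Dini derivatives, desingularization and length bounds -/

/-- The lower right Dini derivative of `e` at `t` is at most `m`. -/
def LowerRightDiniLE (e : ℝ → ℝ) (t m : ℝ) : Prop :=
  ∀ r : ℝ, m < r → ∃ᶠ z in 𝓝[>] t, slope e t z < r

theorem LowerRightDiniLE.mono {e : ℝ → ℝ} {t m m' : ℝ} (h : LowerRightDiniLE e t m)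
    (hm : m ≤ m') : LowerRightDiniLE e t m' :=
  fun r hr => h r (hm.trans_lt hr)

theorem le_of_lowerRightDiniLE_zero {e : ℝ → ℝ} {T : ℝ} (hc : ContinuousOn e (Ici T))
    (h : ∀ t, T ≤ t → LowerRightDiniLE e t 0) {s t : ℝ} (hs : T ≤ s) (hst : s ≤ t) :
    e t ≤ e s :=
  image_le_of_liminf_slope_right_le_deriv_boundary (B := fun _ => e s) (B' := fun _ => 0)
    (hc.mono fun _ hu => hs.trans hu.1) le_rfl continuousOn_const
    (fun _ _ => hasDerivWithinAt_const _ _ _) (fun u hu => h u (hs.trans hu.1)) ⟨hst, le_rfl⟩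

/-- A lower derivative only controls quotients frequently, so the other summand must do so
eventually; two lower Dini bounds could not be added. -/
theorem LowerRightDiniLE.add_hasDerivWithinAt {e w : ℝ → ℝ} {t m w' k : ℝ} (hk : 0 < k)
    (he : LowerRightDiniLE e t m) (hw : HasDerivWithinAt w w' (Ioi t) t) :
    LowerRightDiniLE (fun s => w s + k * e s) t (w' + k * m) := by
  intro r hr
  rw [hasDerivWithinAt_iff_tendsto_slope' self_notMem_Ioi] at hw
  set δ := r - (w' + k * m) with hδ
  have hδ0 : 0 < δ := by linarith
  have h1 : ∀ᶠ z in 𝓝[>] t, slope w t z < w' + δ / 2 := hw.eventually_lt_const (by linarith)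
  have h2 := he (m + δ / (2 * k)) (by have : 0 < δ / (2 * k) := by positivity
                                      linarith)
  refine (h2.and_eventually h1).mono fun z hz => ?_
  have h3 : slope (fun s => w s + k * e s) t z = slope w t z + k * slope e t z := by
    simp only [slope_def_field]; ring
  have h4 : k * slope e t z < k * (m + δ / (2 * k)) := mul_lt_mul_of_pos_left hz.1 hk
  have h5 : k * (m + δ / (2 * k)) = k * m + δ / 2 := by field_simp
  rw [h3]; linarith [hz.2]

theorem LowerRightDiniLE.sub_const {e : ℝ → ℝ} {t m : ℝ} (h : LowerRightDiniLE e t m) (k : ℝ) :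
    LowerRightDiniLE (fun s => e s - k) t m := fun r hr =>
  (h r hr).mono fun z hz => by simpa [slope_def_field] using hz

/-- Concavity of the power, from Bernoulli's inequality at `v / u - 1`; it serves as a chain rule
for Dini derivatives. -/
theorem rpow_le_tangent {p u v : ℝ} (hp0 : 0 ≤ p) (hp1 : p ≤ 1) (hu : 0 < u) (hv : 0 ≤ v) :
    v ^ p ≤ u ^ p + p * u ^ (p - 1) * (v - u) := by
  have h := rpow_one_add_le_one_add_mul_self (s := v / u - 1)
    (by have := div_nonneg hv hu.le; linarith) hp0 hp1
  rw [show 1 + (v / u - 1) = v / u by ring, Real.div_rpow hv hu.le,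
    div_le_iff₀ (Real.rpow_pos_of_pos hu _)] at h
  rw [Real.rpow_sub_one hu.ne']
  calc v ^ p ≤ _ := h
    _ = _ := by field_simp

/-- If `e` decreases at rate `c N²` and satisfies the Łojasiewicz inequality `e ^ θ ≤ K N`, then
`e ^ (1 - θ)` decreases at rate proportional to `N`. -/
theorem lowerRightDiniLE_rpow {e : ℝ → ℝ} {t c K N θ : ℝ} (hc : 0 < c) (hK : 0 < K) (hN : 0 ≤ N)
    (hθ1 : θ < 1) (hθ0 : 0 < θ) (hnn : ∀ s, t ≤ s → 0 ≤ e s) (hanti : ∀ s, t ≤ s → e s ≤ e t)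
    (hd : LowerRightDiniLE e t (-(c * N ^ 2))) (hloj : e t ^ θ ≤ K * N) :
    LowerRightDiniLE (fun s => e s ^ (1 - θ)) t (-(c * (1 - θ) / K * N)) := by
  intro r hr
  -- If `e t = 0`, then `e` stays zero, and the dissipation bound forces `N = 0`. Otherwise the
  -- tangent line of `e ^ (1 - θ)` at `e t` applies.
  rcases (hnn t le_rfl).eq_or_lt with h0 | hpos
  · have hz : ∀ s, t ≤ s → e s = 0 := fun s hs =>
      le_antisymm ((hanti s hs).trans h0.ge) (hnn s hs)
    have hsl : ∀ z ∈ Ioi t, slope e t z = 0 := fun z hz' => by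
      simp [slope_def_field, hz z (le_of_lt hz'), hz t le_rfl]
    have hN0 : N = 0 := by
      by_contra hne
      have hneg : -(c * N ^ 2) < 0 := by
        have : 0 < c * N ^ 2 := by positivity
        linarith
      obtain ⟨z, hz1, hz2⟩ := ((hd 0 hneg).and_eventually self_mem_nhdsWithin).exists
      rw [hsl z hz2] at hz1
      exact lt_irrefl _ hz1
    subst hN0
    refine Eventually.frequently ?_
    filter_upwards [self_mem_nhdsWithin] with z hz'
    simp only [slope_def_field, hz z (le_of_lt hz'), hz t le_rfl]
    simpa using hr
  · set q := (1 - θ) * e t ^ (-θ) with hq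
    have hq0 : 0 < q := mul_pos (by linarith) (Real.rpow_pos_of_pos hpos _)
    have hkey : q * (-(c * N ^ 2)) ≤ -(c * (1 - θ) / K * N) := by
      have h1 : e t ^ (-θ) * (K * N) ≥ 1 := by
        rw [Real.rpow_neg hpos.le]
        have := Real.rpow_pos_of_pos hpos θ
        rw [ge_iff_le, inv_mul_eq_div, le_div_iff₀ this]
        simpa using hloj
      have h2 : c * (1 - θ) / K * N * (e t ^ (-θ) * (K * N)) = q * (c * N ^ 2) := by
        rw [hq]; field_simp
      have h3 : 0 ≤ c * (1 - θ) / K * N := by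
        have : 0 < 1 - θ := by linarith
        positivity
      nlinarith
    have h := hd (r / q) (by rw [lt_div_iff₀ hq0]; linarith [mul_comm q (-(c * N ^ 2))])
    refine (h.and_eventually self_mem_nhdsWithin).mono fun z hz => ?_
    have hzt : 0 < z - t := sub_pos.2 hz.2
    have h1 := rpow_le_tangent (p := 1 - θ) (by linarith) (by linarith) hpos
      (hnn z (le_of_lt hz.2))
    rw [show 1 - θ - 1 = -θ by ring, ← hq] at h1
    have h2 := hz.1
    rw [slope_def_field, div_lt_div_iff₀ hzt hq0] at h2
    rw [slope_def_field, div_lt_iff₀ hzt]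
    linarith

/-- For a fixed unit vector `v`, the scalar function `⟨v, w⟩ + ψ / k` is nonincreasing. Taking `v`
along `w s - w t` bounds the displacement without integrating `‖w'‖`; then `s → ∞`. -/
theorem norm_sub_le_of_lowerRightDiniLE {V : Type*} [NormedAddCommGroup V]
    [InnerProductSpace ℝ V] {w w' : ℝ → V} {wlim : V} {ψ N : ℝ → ℝ} {T k : ℝ} (hk : 0 < k)
    (hψc : ContinuousOn ψ (Ici T)) (hψ0 : ∀ t, T ≤ t → 0 ≤ ψ t)
    (hψ : ∀ t, T ≤ t → LowerRightDiniLE ψ t (-(k * N t)))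
    (hw : ∀ t, T ≤ t → HasDerivWithinAt w (w' t) (Ici t) t) (hwc : ContinuousOn w (Ici T))
    (hwN : ∀ t, T ≤ t → ‖w' t‖ ≤ N t) (hlim : Tendsto w atTop (𝓝 wlim)) {t : ℝ} (ht : T ≤ t) :
    ‖w t - wlim‖ ≤ k⁻¹ * ψ t := by
  have key : ∀ s, t ≤ s → ‖w s - w t‖ ≤ k⁻¹ * ψ t := by
    intro s hs
    rcases eq_or_ne (w s - w t) 0 with h0 | h0
    · rw [h0, norm_zero]
      exact mul_nonneg (inv_nonneg.2 hk.le) (hψ0 t ht)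
    set v : V := ‖w s - w t‖⁻¹ • (w s - w t) with hv
    have hvn : ‖v‖ = 1 := by
      rw [hv, norm_smul, norm_inv, norm_norm, inv_mul_cancel₀ (norm_ne_zero_iff.2 h0)]
    have hle := le_of_lowerRightDiniLE_zero (e := fun u => inner ℝ v (w u) + k⁻¹ * ψ u) (T := T)
      ((continuousOn_const.inner hwc).add (continuousOn_const.mul hψc)) (fun u hu => by
        have hd : HasDerivWithinAt (fun u => inner ℝ v (w u)) (inner ℝ v (w' u)) (Ioi u) u := by
          have := (hasDerivWithinAt_const u (Ioi u) v).inner ℝ ((hw u hu).mono Ioi_subset_Ici_self)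
          simpa using this
        refine ((hψ u hu).add_hasDerivWithinAt (inv_pos.2 hk) hd).mono ?_
        have h1 : inner ℝ v (w' u) ≤ N u :=
          (real_inner_le_norm _ _).trans (by rw [hvn, one_mul]; exact hwN u hu)
        have h2 : k⁻¹ * -(k * N u) = -N u := by field_simp
        rw [h2]; linarith) ht hs
    have h1 : inner ℝ v (w s) - inner ℝ v (w t) = ‖w s - w t‖ := by
      rw [← inner_sub_right, hv, real_inner_smul_left, real_inner_self_eq_norm_sq]
      have := norm_ne_zero_iff.2 h0
      field_simp
    have h2 : 0 ≤ k⁻¹ * ψ s := mul_nonneg (inv_nonneg.2 hk.le) (hψ0 s (ht.trans hs))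
    linarith
  have hlim' : Tendsto (fun s => ‖w s - w t‖) atTop (𝓝 ‖wlim - w t‖) :=
    (hlim.sub_const _).norm
  rw [norm_sub_rev]
  exact le_of_tendsto hlim' ((eventually_ge_atTop t).mono key)

/-! ### Comparison for the differential inequality `e' ≤ -c e ^ (2θ)` -/

section Rates

variable {e : ℝ → ℝ} {T c θ : ℝ}

/-- Only a strict supersolution `B` is needed. The applications take explicit solutions with rate `c
/ 2`, started from the positive value `e T + 1`, so that the inequality is strict. -/
theorem le_of_hasDerivAt_comparison {B B' : ℝ → ℝ} {t : ℝ} (hec : ContinuousOn e (Ici T))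
    (hd : ∀ t, T ≤ t → LowerRightDiniLE e t (-(c * e t ^ (2 * θ)))) (hT : e T ≤ B T)
    (hBc : ContinuousOn B (Icc T t)) (hB : ∀ s ∈ Ico T t, HasDerivAt B (B' s) s)
    (hB' : ∀ s ∈ Ico T t, -(c * B s ^ (2 * θ)) < B' s) (ht : T ≤ t) : e t ≤ B t :=
  image_le_of_liminf_slope_right_lt_deriv_boundary' (f' := fun t => -(c * e t ^ (2 * θ)))
    (hec.mono fun _ hu => hu.1) (fun u hu => hd u hu.1) hT hBc
    (fun s hs => (hB s hs).hasDerivWithinAt) (fun s hs h => by rw [h]; exact hB' s hs) ⟨ht, le_rfl⟩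

theorem exp_decay_of_lowerRightDiniLE (hc : 0 < c) (he0 : 0 ≤ e T) (hec : ContinuousOn e (Ici T))
    (hd : ∀ t, T ≤ t → LowerRightDiniLE e t (-(c * e t ^ (2 * (1 / 2 : ℝ))))) {t : ℝ}
    (ht : T ≤ t) : e t ≤ (e T + 1) * Real.exp (-(c / 2) * (t - T)) := by
  have hB : ∀ s, HasDerivAt (fun s => (e T + 1) * Real.exp (-(c / 2) * (s - T)))
      ((e T + 1) * (Real.exp (-(c / 2) * (s - T)) * (-(c / 2)))) s := fun s => by
    have h1 : HasDerivAt (fun s => -(c / 2) * (s - T)) (-(c / 2)) s := by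
      simpa using ((hasDerivAt_id s).sub_const T).const_mul (-(c / 2))
    exact h1.exp.const_mul _
  refine le_of_hasDerivAt_comparison (θ := 1 / 2) hec hd (by simp)
    (fun s _ => (hB s).continuousAt.continuousWithinAt) (fun s _ => hB s) (fun s _ => ?_) ht
  have : 0 < (e T + 1) * Real.exp (-(c / 2) * (s - T)) := by positivity
  rw [show 2 * (1 / 2 : ℝ) = 1 by norm_num, Real.rpow_one]
  have := mul_pos hc this
  linarith

theorem power_decay_of_lowerRightDiniLE (hc : 0 < c) (hθ : 1 / 2 < θ) (he0 : 0 ≤ e T)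
    (hec : ContinuousOn e (Ici T))
    (hd : ∀ t, T ≤ t → LowerRightDiniLE e t (-(c * e t ^ (2 * θ)))) :
    ∃ a b : ℝ, 0 < a ∧ 0 < b ∧ ∀ t, T ≤ t → e t ≤ (a * (t - T) + b) ^ (-(1 / (2 * θ - 1))) := by
  have hκ : 0 < 2 * θ - 1 := by linarith
  set r := 1 / (2 * θ - 1) with hr
  have hr0 : 0 < r := by positivity
  set a := c / (2 * r) with ha
  have ha0 : 0 < a := by positivity
  set b := (e T + 1) ^ (-(2 * θ - 1)) with hb
  have hb0 : 0 < b := Real.rpow_pos_of_pos (by linarith) _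
  refine ⟨a, b, ha0, hb0, fun t ht => ?_⟩
  have hpos : ∀ s, T ≤ s → 0 < a * (s - T) + b := fun s hs => by
    have := mul_nonneg ha0.le (sub_nonneg.2 hs)
    linarith
  have hB : ∀ s, T ≤ s → HasDerivAt (fun s => (a * (s - T) + b) ^ (-r))
      (a * (-r) * (a * (s - T) + b) ^ (-r - 1)) s := fun s hs => by
    have h1 : HasDerivAt (fun s => a * (s - T) + b) a s := by
      simpa using (((hasDerivAt_id s).sub_const T).const_mul a).add_const b
    exact h1.rpow_const (Or.inl (hpos s hs).ne')
  refine le_of_hasDerivAt_comparison hec hd ?_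
    (fun s hs => (hB s hs.1).continuousAt.continuousWithinAt) (fun s hs => hB s hs.1)
    (fun s hs => ?_) ht
  · rw [sub_self, mul_zero, zero_add, hb, ← Real.rpow_mul (by linarith)]
    rw [show -(2 * θ - 1) * -r = 1 by rw [hr]; field_simp, Real.rpow_one]
    linarith
  · have hp := hpos s hs.1
    rw [← Real.rpow_mul hp.le, show -r * (2 * θ) = -r - 1 by rw [hr]; field_simp; ring]
    have h2 := Real.rpow_pos_of_pos hp (-r - 1)
    have h3 : a * (-r) = -(c / 2) := by rw [ha]; field_simp
    rw [h3]
    nlinarith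

theorem finite_extinction_of_lowerRightDiniLE (hc : 0 < c) (hθ : θ < 1 / 2) (hθ0 : 0 < θ)
    (he0 : 0 ≤ e T) (hec : ContinuousOn e (Ici T))
    (hd : ∀ t, T ≤ t → LowerRightDiniLE e t (-(c * e t ^ (2 * θ)))) :
    ∃ T' : ℝ, T ≤ T' ∧ e T' ≤ 0 := by
  have hκ : 0 < 1 - 2 * θ := by linarith
  set r := 1 / (1 - 2 * θ) with hr
  have hr0 : 0 < r := by positivity
  set a := c / (2 * r) with ha
  have ha0 : 0 < a := by positivity
  set b := (e T + 1) ^ (1 - 2 * θ) with hb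
  have hb0 : 0 < b := Real.rpow_pos_of_pos (by linarith) _
  have hT' : T ≤ T + b / a := by have := div_pos hb0 ha0; linarith
  -- This is the time at which the barrier `(b - a (s - T)) ^ r` vanishes; before it the base is
  -- positive and the barrier differentiable.
  refine ⟨T + b / a, hT', ?_⟩
  have hpos : ∀ s, s < T + b / a → 0 < b - a * (s - T) := fun s hs => by
    have : s - T < b / a := by linarith
    rw [lt_div_iff₀ ha0] at this
    linarith
  have hB1 : ∀ s, HasDerivAt (fun s => b - a * (s - T)) (-a) s := fun s => by
    simpa using (((hasDerivAt_id s).sub_const T).const_mul a).const_sub b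
  have hB : ∀ s, s < T + b / a → HasDerivAt (fun s => (b - a * (s - T)) ^ r)
      (-a * r * (b - a * (s - T)) ^ (r - 1)) s := fun s hs =>
    (hB1 s).rpow_const (Or.inl (hpos s hs).ne')
  have hle := le_of_hasDerivAt_comparison (B := fun s => (b - a * (s - T)) ^ r) hec hd ?_
    (Continuous.continuousOn (Continuous.rpow_const (by fun_prop) fun _ => Or.inr hr0.le))
    (fun s hs => hB s hs.2) (fun s hs => ?_) hT'
  · have h0 : b - a * (T + b / a - T) = 0 := by field_simp; ring
    rwa [h0, Real.zero_rpow hr0.ne'] at hle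
  · simp only [sub_self, mul_zero, sub_zero]
    rw [hb, ← Real.rpow_mul (by linarith)]
    rw [show (1 - 2 * θ) * r = 1 by rw [hr]; field_simp, Real.rpow_one]
    linarith
  · have hp := hpos s hs.2
    rw [← Real.rpow_mul hp.le, show r * (2 * θ) = r - 1 by rw [hr]; field_simp; ring]
    have h2 := Real.rpow_pos_of_pos hp (r - 1)
    have h3 : -a * r = -(c / 2) := by rw [ha]; field_simp
    rw [h3]
    nlinarith

end Rates

/-! ### Rates from dissipation and the Łojasiewicz inequality -/

/-- Convergence rates for a curve `x` with velocity `a` and acceleration `b` whose energy gap `e`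
is dissipated at rate `c (‖a‖ + ‖b‖)²` and satisfies `e ^ θ ≤ K (‖a‖ + ‖b‖)`. -/
theorem convergence_rates_of_lojasiewicz {V : Type*} [NormedAddCommGroup V]
    [InnerProductSpace ℝ V] {x a b : ℝ → V} {xbar : V} {e : ℝ → ℝ} {T c K θ : ℝ} (hc : 0 < c)
    (hK : 0 < K) (hθ0 : 0 < θ) (hθ1 : θ < 1) (hec : ContinuousOn e (Ici T))
    (he : Tendsto e atTop (𝓝 0)) (hxc : ContinuousOn x (Ici T)) (hac : ContinuousOn a (Ici T))
    (hx : ∀ t, T ≤ t → HasDerivWithinAt x (a t) (Ici t) t)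
    (ha : ∀ t, T ≤ t → HasDerivWithinAt a (b t) (Ici t) t)
    (hxlim : Tendsto x atTop (𝓝 xbar)) (halim : Tendsto a atTop (𝓝 0))
    (hd : ∀ t, T ≤ t → LowerRightDiniLE e t (-(c * (‖a t‖ + ‖b t‖) ^ 2)))
    (hloj : ∀ t, T ≤ t → |e t| ^ θ ≤ K * (‖a t‖ + ‖b t‖)) :
    ∃ a₁ a₂ a₃ a₄ t₀ : ℝ, 0 < a₁ ∧ 0 < a₂ ∧ 0 < a₃ ∧ 0 < a₄ ∧ 0 < t₀ ∧
      ∀ t : ℝ, t₀ ≤ t →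
        (θ < 1 / 2 → x t = xbar) ∧
        (θ = 1 / 2 →
          ‖x t - xbar‖ ≤ a₁ * Real.exp (-a₂ * t) ∧ ‖a t‖ ≤ a₁ * Real.exp (-a₂ * t)) ∧
        (1 / 2 < θ →
          ‖x t - xbar‖ ≤ (a₃ * t + a₄) ^ (-((1 - θ) / (2 * θ - 1))) ∧
          ‖a t‖ ≤ (a₃ * t + a₄) ^ (-((1 - θ) / (2 * θ - 1)))) := by
  have hanti : ∀ s t, T ≤ s → s ≤ t → e t ≤ e s := fun s t hs hst =>
    le_of_lowerRightDiniLE_zero hec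
      (fun u hu => (hd u hu).mono (by have : 0 ≤ c * (‖a u‖ + ‖b u‖) ^ 2 := by positivity
                                      linarith)) hs hst
  have hnn : ∀ t, T ≤ t → 0 ≤ e t := fun t ht =>
    le_of_tendsto he ((eventually_ge_atTop t).mono fun s hs => hanti t s ht hs)
  have hloj' : ∀ t, T ≤ t → e t ^ θ ≤ K * (‖a t‖ + ‖b t‖) := fun t ht => by
    simpa [abs_of_nonneg (hnn t ht)] using hloj t ht
  have h1θ : 0 < 1 - θ := by linarith
  set k := c * (1 - θ) / K with hk
  have hk0 : 0 < k := by positivity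
  have hψ : ∀ t, T ≤ t →
      LowerRightDiniLE (fun s => e s ^ (1 - θ)) t (-(k * (‖a t‖ + ‖b t‖))) := fun t ht =>
    lowerRightDiniLE_rpow hc hK (by positivity) hθ1 hθ0 (fun s hs => hnn s (ht.trans hs))
      (fun s hs => hanti t s ht hs) (hd t ht) (hloj' t ht)
  have hψc : ContinuousOn (fun s => e s ^ (1 - θ)) (Ici T) :=
    hec.rpow_const fun _ _ => Or.inr h1θ.le
  have hψ0 : ∀ t, T ≤ t → 0 ≤ e t ^ (1 - θ) := fun t ht => Real.rpow_nonneg (hnn t ht) _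
  -- The same length bound serves twice: for `x` with derivative `a`, and for `a` with derivative
  -- `b` and limit zero.
  have hX : ∀ t, T ≤ t → ‖x t - xbar‖ ≤ k⁻¹ * e t ^ (1 - θ) := fun t ht =>
    norm_sub_le_of_lowerRightDiniLE hk0 hψc hψ0 hψ hx hxc
      (fun s _ => le_add_of_nonneg_right (norm_nonneg _)) hxlim ht
  have hA : ∀ t, T ≤ t → ‖a t‖ ≤ k⁻¹ * e t ^ (1 - θ) := fun t ht => by
    simpa using norm_sub_le_of_lowerRightDiniLE hk0 hψc hψ0 hψ ha hac
      (fun s _ => le_add_of_nonneg_left (norm_nonneg _)) halim ht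
  have hd' : ∀ t, T ≤ t → LowerRightDiniLE e t (-(c / K ^ 2 * e t ^ (2 * θ))) := fun t ht => by
    refine (hd t ht).mono ?_
    have h1 : e t ^ (2 * θ) = (e t ^ θ) ^ 2 := by
      rw [mul_comm, Real.rpow_mul (hnn t ht)]; norm_cast
    have h2 : (e t ^ θ) ^ 2 ≤ (K * (‖a t‖ + ‖b t‖)) ^ 2 :=
      pow_le_pow_left₀ (Real.rpow_nonneg (hnn t ht) _) (hloj' t ht) 2
    have h3 : c / K ^ 2 * (e t ^ θ) ^ 2 ≤ c / K ^ 2 * (K * (‖a t‖ + ‖b t‖)) ^ 2 :=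
      mul_le_mul_of_nonneg_left h2 (by positivity)
    have h4 : c / K ^ 2 * (K * (‖a t‖ + ‖b t‖)) ^ 2 = c * (‖a t‖ + ‖b t‖) ^ 2 := by
      field_simp
    rw [h1]; linarith
  have hc' : 0 < c / K ^ 2 := by positivity
  rcases lt_trichotomy θ (1 / 2) with hθ | hθ | hθ
  · obtain ⟨T', hT', h0⟩ := finite_extinction_of_lowerRightDiniLE hc' hθ hθ0 (hnn T le_rfl) hec hd'
    refine ⟨1, 1, 1, 1, max T' 1, one_pos, one_pos, one_pos, one_pos, by positivity,
      fun t ht => ⟨fun _ => ?_, fun h => by linarith, fun h => by linarith⟩⟩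
    have htT' : T' ≤ t := (le_max_left _ _).trans ht
    have htT : T ≤ t := hT'.trans htT'
    have he0 : e t = 0 := le_antisymm ((hanti T' t hT' htT').trans h0) (hnn t htT)
    have := hX t htT
    rw [he0, Real.zero_rpow h1θ.ne', mul_zero] at this
    exact sub_eq_zero.1 (norm_le_zero_iff.1 this)
  · subst hθ
    set c' := c / K ^ 2 with hcd
    have hE := hnn T le_rfl
    set M := k⁻¹ * (((e T + 1) * Real.exp (c' / 2 * T)) ^ (1 - 1 / 2 : ℝ)) with hM
    have hM0 : 0 < M := by positivity
    have hbd : ∀ t, T ≤ t → k⁻¹ * e t ^ (1 - 1 / 2 : ℝ) ≤ M * Real.exp (-(c' / 4) * t) := by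
      intro t ht
      have h1 := exp_decay_of_lowerRightDiniLE hc' hE hec hd' ht
      have h2 : (e T + 1) * Real.exp (-(c' / 2) * (t - T)) =
          ((e T + 1) * Real.exp (c' / 2 * T)) * Real.exp (-(c' / 2) * t) := by
        rw [mul_assoc, ← Real.exp_add]; ring_nf
      rw [h2] at h1
      have h3 := Real.rpow_le_rpow (hnn t ht) h1 h1θ.le
      rw [Real.mul_rpow (by positivity) (by positivity), ← Real.exp_mul] at h3
      have h4 : -(c' / 2) * t * (1 - 1 / 2) = -(c' / 4) * t := by ring
      rw [h4] at h3
      calc k⁻¹ * e t ^ (1 - 1 / 2 : ℝ) ≤ k⁻¹ * _ :=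
            mul_le_mul_of_nonneg_left h3 (inv_nonneg.2 hk0.le)
        _ = _ := by rw [hM]; ring
    refine ⟨M, c' / 4, 1, 1, max T 1, hM0, by positivity, one_pos, one_pos, by positivity,
      fun t ht => ⟨fun h => absurd h (lt_irrefl _), fun _ => ?_, fun h => absurd h (lt_irrefl _)⟩⟩
    have htT : T ≤ t := (le_max_left _ _).trans ht
    exact ⟨(hX t htT).trans (hbd t htT), (hA t htT).trans (hbd t htT)⟩
  · obtain ⟨α, δ, hα, hδ, hdec⟩ := power_decay_of_lowerRightDiniLE hc' hθ (hnn T le_rfl) hec hd'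
    have hκ : 0 < 2 * θ - 1 := by linarith
    set ρ := (1 - θ) / (2 * θ - 1) with hρ
    have hρ0 : 0 < ρ := by positivity
    -- Chosen so that `M ^ (-ρ) = k⁻¹`, which absorbs the prefactor into the base. Taking `t ≥ 2
    -- |T|` below gives `t - T ≥ t / 2`, removing the time shift.
    set M := (k⁻¹) ^ (-(1 / ρ)) with hM
    have hM0 : 0 < M := Real.rpow_pos_of_pos (inv_pos.2 hk0) _
    refine ⟨1, 1, M * (α / 2), M * δ, max (2 * |T|) 1, one_pos, one_pos, by positivity,
      by positivity, by positivity,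
      fun t ht => ⟨fun h => by linarith, fun h => by linarith, fun _ => ?_⟩⟩
    have h2T : 2 * |T| ≤ t := (le_max_left _ _).trans ht
    have ht1 : 1 ≤ t := (le_max_right _ _).trans ht
    have habs := le_abs_self T
    have habs0 := abs_nonneg T
    have htT : T ≤ t := by linarith
    have hbase : α / 2 * t + δ ≤ α * (t - T) + δ := by nlinarith
    have hb0 : 0 < α / 2 * t + δ := by positivity
    have hbd : k⁻¹ * e t ^ (1 - θ) ≤ (M * (α / 2) * t + M * δ) ^ (-ρ) := by
      have h1 := Real.rpow_le_rpow (hnn t htT) (hdec t htT) h1θ.le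
      rw [← Real.rpow_mul (by linarith)] at h1
      rw [show -(1 / (2 * θ - 1)) * (1 - θ) = -ρ by rw [hρ]; ring] at h1
      have h2 : (α * (t - T) + δ) ^ (-ρ) ≤ (α / 2 * t + δ) ^ (-ρ) :=
        Real.rpow_le_rpow_of_nonpos hb0 hbase (by linarith)
      rw [show M * (α / 2) * t + M * δ = M * (α / 2 * t + δ) by ring,
        Real.mul_rpow hM0.le hb0.le, hM, ← Real.rpow_mul (inv_pos.2 hk0).le,
        show -(1 / ρ) * -ρ = 1 by field_simp, Real.rpow_one]
      exact mul_le_mul_of_nonneg_left (h1.trans h2) (inv_nonneg.2 hk0.le)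
    exact ⟨(hX t htT).trans hbd, (hA t htT).trans hbd⟩

/-! ### Proximal points and subgradients -/

namespace ProxGrad

theorem IsProx.ne_top {V : Type*} [NormedAddCommGroup V] [InnerProductSpace ℝ V]
    {f : V → EReal} (hf_proper : ∃ u, f u ≠ ⊤)
    {lam : ℝ} {z p : V} (h : IsProx f lam z p) : f p ≠ ⊤ := by
  obtain ⟨u, hu⟩ := hf_proper
  intro hp
  have h1 := h u
  rw [hp, EReal.top_add_coe, top_le_iff] at h1
  exact EReal.add_ne_top hu (EReal.coe_ne_top _) h1

theorem nonpos_of_forall_le_mul {a k : ℝ} (h : ∀ τ : ℝ, 0 < τ → τ < 1 → a ≤ τ * k) : a ≤ 0 := by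
  have h1 : Tendsto (fun τ : ℝ => τ * k) (𝓝[>] 0) (𝓝 (0 * k)) :=
    (tendsto_id.mul_const k).mono_left nhdsWithin_le_nhds
  rw [zero_mul] at h1
  refine ge_of_tendsto h1 ?_
  filter_upwards [Ioo_mem_nhdsGT (zero_lt_one (α := ℝ))] with τ hτ
  exact h τ hτ.1 hτ.2

/-- The residual of a proximal point is a convex subgradient there. -/
theorem IsProx.subgradient {V : Type*} [NormedAddCommGroup V] [InnerProductSpace ℝ V]
    {f : V → EReal} (hf_bot : ∀ u, f u ≠ ⊥) (hf_proper : ∃ u, f u ≠ ⊤) (hf_convex : ConvexFun f)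
    {lam : ℝ} (hlam : 0 < lam) {z p : V} (h : IsProx f lam z p) (u : V) :
    (((f p).toReal + inner ℝ (lam⁻¹ • (z - p)) (u - p) : ℝ) : EReal) ≤ f u := by
  rcases eq_or_ne (f u) ⊤ with hu | hu
  · rw [hu]; exact le_top
  have hp := h.ne_top hf_proper
  obtain ⟨fu, hfu⟩ : ∃ r : ℝ, f u = r := ⟨_, (EReal.coe_toReal hu (hf_bot u)).symm⟩
  obtain ⟨fp, hfp⟩ : ∃ r : ℝ, f p = r := ⟨_, (EReal.coe_toReal hp (hf_bot p)).symm⟩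
  rw [hfu, hfp, EReal.toReal_coe, EReal.coe_le_coe_iff, ← sub_nonpos]
  -- Test minimality of `p` at `τ u + (1 - τ) p`, divide by `τ` and let `τ → 0`; the quadratic
  -- remainder contributes the factor `τ`.
  apply nonpos_of_forall_le_mul (k := 1 / (2 * lam) * ‖u - p‖ ^ 2)
  intro τ hτ0 hτ1
  have h1 := hf_convex u p τ (1 - τ) hτ0 (by linarith) (by ring)
  have h2 := (h (τ • u + (1 - τ) • p)).trans (add_le_add_left h1 _)
  rw [hfu, hfp] at h2
  norm_cast at h2
  have h3 : τ • u + (1 - τ) • p - z = (p - z) + τ • (u - p) := by module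
  rw [h3, norm_add_sq_real, real_inner_smul_right, norm_smul, Real.norm_of_nonneg hτ0.le] at h2
  rw [real_inner_smul_left, ← neg_sub p z, inner_neg_left]
  have h4 : τ * (fp + lam⁻¹ * -inner ℝ (p - z) (u - p) - fu)
      ≤ τ * (τ * (1 / (2 * lam) * ‖u - p‖ ^ 2)) := by
    have : 1 / (2 * lam) * (‖p - z‖ ^ 2 + 2 * (τ * inner ℝ (p - z) (u - p)) + (τ * ‖u - p‖) ^ 2)
      = 1 / (2 * lam) * ‖p - z‖ ^ 2 + lam⁻¹ * (τ * inner ℝ (p - z) (u - p))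
        + τ * (τ * (1 / (2 * lam) * ‖u - p‖ ^ 2)) := by field_simp
    rw [this] at h2
    linarith
  exact le_of_mul_le_mul_left h4 hτ0

/-- A differentiable minorant of `h` that is exact at `x` has its gradient in the Fréchet
subdifferential of `h` at `x`. -/
theorem mem_frechetSubdiff_of_minorant {W : Type*} [NormedAddCommGroup W] [InnerProductSpace ℝ W]
    {h : W → EReal} {φ : W → ℝ} {x v : W} (hx : h x = φ x) (hφ : ∀ y, (φ y : EReal) ≤ h y)
    (hd : HasFDerivAt φ (innerSL ℝ v) x) : v ∈ frechetSubdiff h x := by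
  refine ⟨by rw [hx]; exact EReal.coe_ne_top _, le_of_forall_lt fun c hc => ?_⟩
  obtain ⟨r, hcr, hr0⟩ := EReal.lt_iff_exists_real_btwn.1 hc
  have hr0' : r < 0 := by exact_mod_cast hr0
  refine hcr.trans_le (le_liminf_of_le (by isBoundedDefault) ?_)
  have ho := hd.isLittleO.def (show 0 < -r by linarith)
  filter_upwards [nhdsWithin_le_nhds ho, self_mem_nhdsWithin] with y hy hyx
  have hn : 0 < ‖y - x‖ := norm_pos_iff.2 (sub_ne_zero.2 hyx)
  have h1 : ((φ y - φ x - inner ℝ v (y - x) : ℝ) : EReal)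
      ≤ h y - h x - ((inner ℝ v (y - x) : ℝ) : EReal) := by
    rw [hx, EReal.coe_sub, EReal.coe_sub]
    exact EReal.sub_le_sub (EReal.sub_le_sub (hφ y) le_rfl) le_rfl
  have h2 := EReal.div_le_div_right_of_nonneg (c := ((‖y - x‖ : ℝ) : EReal))
    (by exact_mod_cast hn.le) h1
  refine le_trans ?_ h2
  rw [← EReal.coe_div, EReal.coe_le_coe_iff, le_div_iff₀ hn]
  rw [Real.norm_eq_abs, innerSL_apply_apply] at hy
  have := (abs_le.1 hy).1
  linarith

theorem frechetSubdiff_subset_limitingSubdiff {W : Type*} [NormedAddCommGroup W]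
    [InnerProductSpace ℝ W] (h : W → EReal) (x : W) : frechetSubdiff h x ⊆ limitingSubdiff h x :=
  fun v hv => ⟨hv.1, fun _ => x, fun _ => v, tendsto_const_nhds, tendsto_const_nhds,
    fun _ => hv, tendsto_const_nhds⟩

theorem norm_triple_le {V : Type*} [NormedAddCommGroup V] (a b c : V) :
    ‖triple a b c‖ ≤ ‖a‖ + ‖b‖ + ‖c‖ := by
  have h : ‖triple a b c‖ ^ 2 = ‖a‖ ^ 2 + ‖b‖ ^ 2 + ‖c‖ ^ 2 := by
    rw [PiLp.norm_sq_eq_of_L2]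
    simp [Fin.sum_univ_three, triple]
  have ha := norm_nonneg a
  have hb := norm_nonneg b
  have hc := norm_nonneg c
  refine le_of_sq_le_sq ?_ (by positivity)
  rw [h]
  nlinarith [mul_nonneg ha hb, mul_nonneg ha hc, mul_nonneg hb hc]

section Triple

variable {V : Type*} [NormedAddCommGroup V] [InnerProductSpace ℝ V]

theorem inner_triple (a b c : V) (z : Triple V) :
    inner ℝ (triple a b c) z = inner ℝ a (z 0) + inner ℝ b (z 1) + inner ℝ c (z 2) := by
  simp [PiLp.inner_apply, Fin.sum_univ_three, triple]

/-- A subgradient `ξ` of `f` at `u` yields an explicit limiting subgradient of the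
regularization. -/
theorem mem_limitingSubdiff_regularization [CompleteSpace V] {f : V → EReal} {g : V → ℝ}
    {lam C : ℝ} (hlam : lam ≠ 0) (hg : Differentiable ℝ g) {u v w ξ : V} (hu : f u ≠ ⊤)
    (hu' : f u ≠ ⊥)
    (hξ : ∀ y, (((f u).toReal + inner ℝ ξ (y - u) : ℝ) : EReal) ≤ f y) :
    triple (ξ + gradient g u + lam⁻¹ • (u - v)) (lam⁻¹ • (v - u)) (-(C / lam) • w) ∈
      limitingSubdiff (regularization f g lam C) (triple u v w) := by
  apply frechetSubdiff_subset_limitingSubdiff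
  -- Replacing `f` by its affine minorant at `u` gives a differentiable minorant of the
  -- regularization, exact at the base point.
  apply mem_frechetSubdiff_of_minorant (φ := fun z => ((f u).toReal + inner ℝ ξ (z 0 - u)) +
    g (z 0) + (1 / (2 * lam) * ‖z 0 - z 1‖ ^ 2 - C / (2 * lam) * ‖z 2‖ ^ 2))
  · have : f u = ((f u).toReal : EReal) := (EReal.coe_toReal hu hu').symm
    simp only [regularization, objective, triple]
    simp only [Matrix.cons_val_zero, sub_self, inner_zero_right, add_zero]
    push_cast
    rw [← this]
  · intro z
    simp only [regularization, objective]
    rw [EReal.coe_add, EReal.coe_add]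
    gcongr
    exact hξ _
  · have p0 : HasFDerivAt (fun z : Triple V => z 0) (PiLp.proj 2 (𝕜 := ℝ) (fun _ : Fin 3 => V) 0)
        (triple u v w) := (PiLp.proj 2 (𝕜 := ℝ) (fun _ : Fin 3 => V) 0).hasFDerivAt
    have p1 : HasFDerivAt (fun z : Triple V => z 1) (PiLp.proj 2 (𝕜 := ℝ) (fun _ : Fin 3 => V) 1)
        (triple u v w) := (PiLp.proj 2 (𝕜 := ℝ) (fun _ : Fin 3 => V) 1).hasFDerivAt
    have p2 : HasFDerivAt (fun z : Triple V => z 2) (PiLp.proj 2 (𝕜 := ℝ) (fun _ : Fin 3 => V) 2)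
        (triple u v w) := (PiLp.proj 2 (𝕜 := ℝ) (fun _ : Fin 3 => V) 2).hasFDerivAt
    have hg' := (hg u).hasGradientAt.hasFDerivAt
    have hg2 : HasFDerivAt (fun z : Triple V => g (z 0)) _ (triple u v w) :=
      HasFDerivAt.comp (triple u v w) (f := fun z : Triple V => z 0) (g := g) hg' p0
    have hi : HasFDerivAt (fun z : Triple V => inner ℝ ξ (z 0 - u)) _ (triple u v w) :=
      (innerSL ℝ ξ).hasFDerivAt.comp (triple u v w) (p0.sub_const u)
    have := ((hi.const_add (f u).toReal).add hg2).add
      (((p0.sub p1).norm_sq.const_mul (1 / (2 * lam))).sub (p2.norm_sq.const_mul (C / (2 * lam))))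
    refine this.congr_fderiv ?_
    ext z
    simp [inner_triple]
    simp [triple, inner_add_left, inner_sub_left, real_inner_smul_left]
    field_simp
    ring

end Triple

section Prox

variable {V : Type*} [NormedAddCommGroup V] [InnerProductSpace ℝ V] {f : V → EReal}

theorem IsProx.subgradient_toReal (hf_bot : ∀ u, f u ≠ ⊥) (hf_convex : ConvexFun f) {lam : ℝ}
    (hlam : 0 < lam) {z p u : V} (h : IsProx f lam z p) (hu : f u ≠ ⊤) :
    (f p).toReal + inner ℝ (lam⁻¹ • (z - p)) (u - p) ≤ (f u).toReal := by
  have := h.subgradient hf_bot ⟨u, hu⟩ hf_convex hlam u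
  rwa [← EReal.coe_toReal hu (hf_bot u), EReal.coe_le_coe_iff] at this

/-- Adding the subgradient inequalities at the two proximal points gives monotonicity, and
Cauchy–Schwarz concludes. -/
theorem IsProx.norm_sub_le (hf_bot : ∀ u, f u ≠ ⊥) (hf_proper : ∃ u, f u ≠ ⊤)
    (hf_convex : ConvexFun f) {lam : ℝ} (hlam : 0 < lam) {z p z' p' : V} (h : IsProx f lam z p)
    (h' : IsProx f lam z' p') : ‖p - p'‖ ≤ ‖z - z'‖ := by
  have h1 := h.subgradient_toReal hf_bot hf_convex hlam (h'.ne_top hf_proper)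
  have h2 := h'.subgradient_toReal hf_bot hf_convex hlam (h.ne_top hf_proper)
  rw [real_inner_smul_left] at h1 h2
  have h3 : lam⁻¹ * (inner ℝ (z - p) (p' - p) + inner ℝ (z' - p') (p - p')) ≤ 0 := by linarith
  have h4 : inner ℝ (z - p) (p' - p) + inner ℝ (z' - p') (p - p') ≤ 0 := by
    by_contra hcon
    exact absurd h3 (not_le.2 (mul_pos (inv_pos.2 hlam) (not_le.1 hcon)))
  have h5 : inner ℝ (z - p) (p' - p) + inner ℝ (z' - p') (p - p')
      = ‖p - p'‖ ^ 2 - inner ℝ (z - z') (p - p') := by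
    rw [← real_inner_self_eq_norm_sq, ← neg_sub p p', inner_neg_right]
    simp only [inner_sub_left, inner_sub_right]
    ring
  have h6 := real_inner_le_norm (z - z') (p - p')
  rcases (norm_nonneg (p - p')).eq_or_lt with h0 | h0
  · rw [← h0]; exact norm_nonneg _
  · refine le_of_mul_le_mul_right ?_ h0
    nlinarith

end Prox

/-! ### Algebra behind the constants `L`, `A`, `B`, `C` -/

section EnergyEstimate

variable {V : Type*} [NormedAddCommGroup V] [InnerProductSpace ℝ V]

/-- The Lipschitz bound with constant `L` for the first order system `(x, x')`. -/
theorem norm_sq_add_norm_sq_le_constL {γ lam β : ℝ} (hγ : 0 < γ) (hlam : 0 < lam) (hβ : 0 ≤ β)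
    {a b d : V} (h : ‖d + γ • b + a‖ ≤ (1 + lam * β) * ‖a‖) :
    ‖b‖ ^ 2 + ‖d‖ ^ 2 ≤ constL γ lam β ^ 2 * (‖a‖ ^ 2 + ‖b‖ ^ 2) := by
  set y := d + γ • b + a with hy
  have hlb : 0 ≤ lam * β := by positivity
  have hd : ‖d‖ ≤ ‖y‖ + ‖a‖ + γ * ‖b‖ := by
    have : d = y - a - γ • b := by rw [hy]; abel
    calc ‖d‖ = ‖y - a - γ • b‖ := by rw [← this]
      _ ≤ ‖y - a‖ + ‖γ • b‖ := norm_sub_le _ _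
      _ ≤ ‖y‖ + ‖a‖ + γ * ‖b‖ := by
        rw [norm_smul, Real.norm_of_nonneg hγ.le]
        linarith [norm_sub_le y a]
  have hp := norm_nonneg a
  have hq := norm_nonneg b
  have hn := norm_nonneg y
  have hd2 : ‖d‖ ^ 2 ≤ (‖y‖ + ‖a‖ + γ * ‖b‖) ^ 2 := pow_le_pow_left₀ (norm_nonneg d) hd 2
  rcases min_choice (constL₁ γ lam β) (constL₂ γ lam β) with hL | hL
  · rw [constL, hL, constL₁, Real.sq_sqrt (le_max_of_le_left (by positivity))]
    -- Cauchy–Schwarz with weights `1, 1, γ`. The other branch first bounds `‖y‖` by `‖a‖` and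
    -- applies Young's inequality to the single cross term.
    have h1 : (‖y‖ + ‖a‖ + γ * ‖b‖) ^ 2 ≤ (γ + 2) * (‖y‖ ^ 2 + ‖a‖ ^ 2 + γ * ‖b‖ ^ 2) := by
      nlinarith [sq_nonneg (‖y‖ - ‖a‖), mul_nonneg hγ.le (sq_nonneg (‖y‖ - ‖b‖)),
        mul_nonneg hγ.le (sq_nonneg (‖a‖ - ‖b‖))]
    have h2 : ‖y‖ ^ 2 ≤ ((1 + lam * β) * ‖a‖) ^ 2 := pow_le_pow_left₀ hn h 2
    have h3 := mul_le_mul_of_nonneg_right (le_max_left ((γ + 1) ^ 2)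
      ((γ + 2) * ((1 + lam * β) ^ 2 + 1))) (sq_nonneg ‖b‖)
    have h4 := mul_le_mul_of_nonneg_right (le_max_right ((γ + 1) ^ 2)
      ((γ + 2) * ((1 + lam * β) ^ 2 + 1))) (sq_nonneg ‖a‖)
    nlinarith
  · rw [constL, hL, constL₂, Real.sq_sqrt (le_max_of_le_left (by positivity))]
    have h1 : ‖d‖ ^ 2 ≤ ((2 + lam * β) * ‖a‖ + γ * ‖b‖) ^ 2 :=
      pow_le_pow_left₀ (norm_nonneg d) (by linarith) 2
    have h3 := mul_le_mul_of_nonneg_right (le_max_left ((γ + 1) ^ 2 + γ * lam * β)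
      ((2 + lam * β) ^ 2 + γ * (2 + lam * β))) (sq_nonneg ‖b‖)
    have h4 := mul_le_mul_of_nonneg_right (le_max_right ((γ + 1) ^ 2 + γ * lam * β)
      ((2 + lam * β) ^ 2 + γ * (2 + lam * β))) (sq_nonneg ‖a‖)
    have h5 : 0 ≤ γ * (2 + lam * β) * (‖a‖ - ‖b‖) ^ 2 := by positivity
    nlinarith

theorem one_le_constL {γ lam β : ℝ} (hγ : 0 < γ) (hlam : 0 < lam) (hβ : 0 ≤ β) :
    1 ≤ constL γ lam β := by
  have h1 : 1 ≤ (γ + 1) ^ 2 := by nlinarith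
  have h2 : 0 ≤ γ * lam * β := by positivity
  exact le_min (Real.one_le_sqrt.2 (le_max_of_le_left h1))
    (Real.one_le_sqrt.2 (le_max_of_le_left (by linarith)))

/-- Here `l = L²`, `d` plays the derivative of `b`, and `e` the gradient difference between `y` and
`x`. The `⟨b, d⟩` terms cancel. The constant `C` cancels the remaining `⟨a, b⟩` terms except `-3βγ
⟨a, b⟩`, kept to offset the cross terms from the two bounds on `e`. Since `γ - κ = γ / (l + 1)`,
Young's inequality with weight `l` on `⟨a, d⟩` leaves exactly the negative parts of `A` and `B`. -/
theorem energy_rate_le {γ lam β l : ℝ} (hγ : 0 < γ) (hlam : 0 < lam) (hβ : 0 ≤ β) (hl : 1 ≤ l)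
    {a b d e : V} (hd : ‖b‖ ^ 2 + ‖d‖ ^ 2 ≤ l * (‖a‖ ^ 2 + ‖b‖ ^ 2))
    (he : ‖e‖ ≤ β * ‖b + γ • a‖) :
    inner ℝ (-(lam⁻¹ • (b + γ • a)) + e) (d + γ • b + a)
      + lam⁻¹ * inner ℝ (b + (γ * (l / (l + 1))) • a) (d + (γ * (l / (l + 1))) • b)
      - (-((2 * l + 1) / (l + 1) ^ 2) * γ ^ 2 + 3 * β * γ * lam - 1) / lam * inner ℝ a b ≤
    (-(1 / 2) * (γ / lam) + β / 2 * (l + 2 * γ ^ 2 + 1)) * ‖a‖ ^ 2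
      + (-(1 / (2 * l)) * (γ / lam) + β / 2 * (l + γ ^ 2 + 1)) * ‖b‖ ^ 2 := by
  have hl0 : 0 < l := by linarith
  set S := ‖b + γ • a‖ with hS
  have hS2 : S ^ 2 = ‖b‖ ^ 2 + 2 * γ * inner ℝ a b + γ ^ 2 * ‖a‖ ^ 2 := by
    rw [hS, norm_add_sq_real, real_inner_smul_right, norm_smul, Real.norm_of_nonneg hγ.le,
      real_inner_comm]
    ring
  have hR2 : ‖γ • b + a‖ ^ 2 = γ ^ 2 * ‖b‖ ^ 2 + 2 * γ * inner ℝ a b + ‖a‖ ^ 2 := by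
    rw [norm_add_sq_real, real_inner_smul_left, norm_smul, Real.norm_of_nonneg hγ.le,
      real_inner_comm]
    ring
  have herr : ∀ w : V, inner ℝ e w ≤ β / 2 * (S ^ 2 + ‖w‖ ^ 2) := fun w => by
    have h1 := real_inner_le_norm e w
    have h2 := mul_le_mul_of_nonneg_right he (norm_nonneg w)
    have h3 := mul_nonneg hβ (sq_nonneg (S - ‖w‖))
    nlinarith
  have he1 := herr d
  have he2 := herr (γ • b + a)
  have had : -inner ℝ a d ≤ (l * ‖a‖ ^ 2 + ‖d‖ ^ 2 / l) / 2 := by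
    have h1 := abs_le.1 (abs_real_inner_le_norm a d)
    have h2 : 0 ≤ (l * ‖a‖ - ‖d‖) ^ 2 / l := by positivity
    have h3 : (l * ‖a‖ - ‖d‖) ^ 2 / l = l * ‖a‖ ^ 2 + ‖d‖ ^ 2 / l - 2 * (‖a‖ * ‖d‖) := by
      field_simp; ring
    linarith [h1.1]
  have hd' : ‖d‖ ^ 2 / l ≤ ‖a‖ ^ 2 + (1 - 1 / l) * ‖b‖ ^ 2 := by
    rw [div_le_iff₀ hl0]
    have : (‖a‖ ^ 2 + (1 - 1 / l) * ‖b‖ ^ 2) * l = l * ‖a‖ ^ 2 + (l - 1) * ‖b‖ ^ 2 := by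
      field_simp
    linarith
  have hexp : inner ℝ (-(lam⁻¹ • (b + γ • a)) + e) (d + γ • b + a)
      + lam⁻¹ * inner ℝ (b + (γ * (l / (l + 1))) • a) (d + (γ * (l / (l + 1))) • b)
      - (-((2 * l + 1) / (l + 1) ^ 2) * γ ^ 2 + 3 * β * γ * lam - 1) / lam * inner ℝ a b
      = γ / (lam * (l + 1)) * (-inner ℝ a d) - γ / (lam * (l + 1)) * ‖b‖ ^ 2 - γ / lam * ‖a‖ ^ 2
        - 3 * β * γ * inner ℝ a b + (inner ℝ e d + inner ℝ e (γ • b + a)) := by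
    simp only [inner_add_left, inner_add_right, inner_neg_left, real_inner_smul_left,
      real_inner_smul_right, ← real_inner_self_eq_norm_sq, real_inner_comm a b]
    field_simp
    ring
  rw [hexp]
  have h1 : γ / (lam * (l + 1)) * (-inner ℝ a d) ≤ γ / (lam * (l + 1)) *
      ((l * ‖a‖ ^ 2 + (‖a‖ ^ 2 + (1 - 1 / l) * ‖b‖ ^ 2)) / 2) :=
    mul_le_mul_of_nonneg_left (by linarith) (by positivity)
  have h2 : γ / (lam * (l + 1)) * ((l * ‖a‖ ^ 2 + (‖a‖ ^ 2 + (1 - 1 / l) * ‖b‖ ^ 2)) / 2)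
      - γ / (lam * (l + 1)) * ‖b‖ ^ 2 - γ / lam * ‖a‖ ^ 2
      = -(1 / 2) * (γ / lam) * ‖a‖ ^ 2 - 1 / (2 * l) * (γ / lam) * ‖b‖ ^ 2 := by
    field_simp
    ring
  have h3 := mul_le_mul_of_nonneg_left hd (show 0 ≤ β / 2 by positivity)
  rw [hR2, hS2] at he2
  rw [hS2] at he1
  linarith

end EnergyEstimate

/-! ### Asymptotics of damped curves -/

section Damped

variable {V : Type*} [NormedAddCommGroup V] [InnerProductSpace ℝ V]

/-- Integrating factor `exp (γ t)`: past a late time, the weighted norm grows no faster than `ε / 2`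
times that factor. -/
theorem tendsto_zero_of_damped {w w' : ℝ → V} {γ : ℝ} (hγ : 0 < γ)
    (hd : ∀ t, 0 ≤ t → HasDerivWithinAt w (w' t) (Ici t) t) (hc : ContinuousOn w (Ici 0))
    (h : Tendsto (fun t => w' t + γ • w t) atTop (𝓝 0)) : Tendsto w atTop (𝓝 0) := by
  rw [Metric.tendsto_nhds]
  intro ε hε
  have h1 : ∀ᶠ t in atTop, ‖w' t + γ • w t‖ < γ * (ε / 2) := by
    have := Metric.tendsto_nhds.1 h (γ * (ε / 2)) (by positivity)
    simpa using this
  obtain ⟨T, hT⟩ := eventually_atTop.1 (h1.and (eventually_ge_atTop 0))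
  have hT0 : 0 ≤ T := (hT T le_rfl).2
  set M := ‖Real.exp (γ * T) • w T‖
  have hexp : ∀ t, HasDerivAt (fun t => Real.exp (γ * t)) (Real.exp (γ * t) * γ) t := fun t => by
    have : HasDerivAt (fun t => γ * t) γ t := by simpa using (hasDerivAt_id t).const_mul γ
    exact this.exp
  have hbd : ∀ t, T ≤ t → ‖Real.exp (γ * t) • w t‖
      ≤ M + ε / 2 * (Real.exp (γ * t) - Real.exp (γ * T)) := fun t ht => by
    refine image_norm_le_of_norm_deriv_right_le_deriv_boundary
      (f := fun t => Real.exp (γ * t) • w t)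
      (f' := fun t => Real.exp (γ * t) • w' t + (Real.exp (γ * t) * γ) • w t)
      (B := fun t => M + ε / 2 * (Real.exp (γ * t) - Real.exp (γ * T)))
      (B' := fun t => ε / 2 * (Real.exp (γ * t) * γ)) (a := T) (b := t) ?_ ?_ ?_ ?_ ?_ ⟨ht, le_rfl⟩
    · exact (Continuous.continuousOn (by fun_prop)).smul (hc.mono fun u hu => hT0.trans hu.1)
    · exact fun u hu => (hexp u).hasDerivWithinAt.smul (hd u (hT0.trans hu.1))
    · simp [M]
    · exact fun u => (((hexp u).sub_const _).const_mul _).const_add _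
    · intro u hu
      have : Real.exp (γ * u) • w' u + (Real.exp (γ * u) * γ) • w u
          = Real.exp (γ * u) • (w' u + γ • w u) := by module
      rw [this, norm_smul, Real.norm_of_nonneg (Real.exp_pos _).le]
      have h2 := mul_le_mul_of_nonneg_left (hT u hu.1).1.le (Real.exp_pos (γ * u)).le
      linarith
  have hdec : Tendsto (fun t => M * Real.exp (-(γ * t))) atTop (𝓝 (M * 0)) :=
    (Real.tendsto_exp_neg_atTop_nhds_zero.comp
      (tendsto_id.const_mul_atTop hγ)).const_mul M
  rw [mul_zero] at hdec
  filter_upwards [eventually_ge_atTop T, hdec.eventually_lt_const (half_pos hε)] with t ht ht2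
  have h3 := hbd t ht
  rw [norm_smul, Real.norm_of_nonneg (Real.exp_pos _).le] at h3
  rw [dist_zero_right]
  have h4 : ‖w t‖ ≤ M * Real.exp (-(γ * t)) + ε / 2 := by
    rw [Real.exp_neg]
    have he := Real.exp_pos (γ * t)
    have h5 : (M * (Real.exp (γ * t))⁻¹ + ε / 2) * Real.exp (γ * t)
        = M + ε / 2 * Real.exp (γ * t) := by field_simp
    refine le_of_mul_le_mul_right ?_ he
    have := mul_pos (half_pos hε) (Real.exp_pos (γ * T))
    rw [h5]; linarith
  linarith

/-- The increment `x (t + 1) - x t` tends both to `0` and, by the mean value inequality, to `c`. -/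
theorem eq_zero_of_tendsto_of_deriv_tendsto {x a : ℝ → V} {xbar c : V}
    (hd : ∀ t, 0 ≤ t → HasDerivWithinAt x (a t) (Ici 0) t) (hx : Tendsto x atTop (𝓝 xbar))
    (ha : Tendsto a atTop (𝓝 c)) : c = 0 := by
  have h0 : Tendsto (fun t => x (t + 1) - x t) atTop (𝓝 (xbar - xbar)) :=
    (hx.comp (tendsto_atTop_add_const_right _ 1 tendsto_id)).sub hx
  have h1 : Tendsto (fun t => x (t + 1) - x t) atTop (𝓝 c) := by
    rw [Metric.tendsto_nhds]
    intro ε hε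
    obtain ⟨T, hT⟩ := eventually_atTop.1
      ((Metric.tendsto_nhds.1 ha (ε / 2) (half_pos hε)).and (eventually_ge_atTop 0))
    filter_upwards [eventually_ge_atTop T] with t ht
    have ht0 := (hT t ht).2
    have := Convex.norm_image_sub_le_of_norm_hasDerivWithin_le (f := fun s => x s - s • c)
      (f' := fun s => a s - (1 : ℝ) • c) (s := Icc t (t + 1)) (x := t) (y := t + 1) (C := ε / 2)
      (fun s hs => ((hd s (ht0.trans hs.1)).mono fun u hu => ht0.trans hu.1).sub
        ((hasDerivWithinAt_id s _).smul_const c))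
      (fun s hs => by
        rw [one_smul, ← dist_eq_norm]; exact (hT s (ht.trans hs.1)).1.le)
      (convex_Icc _ _) ⟨le_rfl, by linarith⟩ ⟨by linarith, le_rfl⟩
    rw [dist_eq_norm]
    have h2 : x (t + 1) - x t - c = x (t + 1) - (t + 1) • c - (x t - t • c) := by module
    rw [h2]
    refine this.trans_lt ?_
    simp only [add_sub_cancel_left, norm_one, mul_one]
    linarith
  rw [sub_self] at h0
  exact tendsto_nhds_unique h1 h0

end Damped

/-! ### Energy and limits along the trajectory -/

/-- The energy along a trajectory with velocity `a` and acceleration `b`, where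
`y = b + γ a + x` is the proximal point. -/
noncomputable def energy {V : Type*} [NormedAddCommGroup V] [InnerProductSpace ℝ V]
    (f : V → EReal) (g : V → ℝ) (γ lam κ C : ℝ) (x a b : ℝ → V) (t : ℝ) : ℝ :=
  (f (b t + γ • a t + x t)).toReal + g (b t + γ • a t + x t) +
    (1 / (2 * lam) * ‖b t + κ • a t‖ ^ 2 - C / (2 * lam) * ‖a t‖ ^ 2)

theorem residual_eq {V : Type*} [AddCommGroup V] [Module ℝ V] {γ lam : ℝ} (hlam : 0 < lam)
    (u v w z : V) :
    lam⁻¹ • (u - lam • z - (w + γ • v + u)) = -(lam⁻¹ • (w + γ • v)) - z := by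
  have : u - lam • z - (w + γ • v + u) = -(w + γ • v) - lam • z := by abel
  rw [this, smul_sub, smul_smul, inv_mul_cancel₀ hlam.ne', one_smul, smul_neg]

section Trajectory

variable {V : Type*} [NormedAddCommGroup V] [InnerProductSpace ℝ V] [CompleteSpace V]
  {f : V → EReal} {g : V → ℝ} {γ lam β : ℝ} {x a b : ℝ → V}

theorem norm_prox_sub_le (hf_bot : ∀ u, f u ≠ ⊥) (hf_proper : ∃ u, f u ≠ ⊤)
    (hf_convex : ConvexFun f) (hlam : 0 < lam)
    (hg_lip : ∀ u v, ‖gradient g u - gradient g v‖ ≤ β * ‖u - v‖) {u v p q : V}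
    (hp : IsProx f lam (u - lam • gradient g u) p)
    (hq : IsProx f lam (v - lam • gradient g v) q) : ‖p - q‖ ≤ (1 + lam * β) * ‖u - v‖ := by
  refine (hp.norm_sub_le hf_bot hf_proper hf_convex hlam hq).trans ?_
  have h1 : u - lam • gradient g u - (v - lam • gradient g v)
      = (u - v) - lam • (gradient g u - gradient g v) := by module
  rw [h1]
  have h2 := norm_sub_le (u - v) (lam • (gradient g u - gradient g v))
  rw [norm_smul, Real.norm_of_nonneg hlam.le] at h2
  have h3 := mul_le_mul_of_nonneg_left (hg_lip u v) hlam.le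
  linarith

theorem continuous_gradient_of_lipschitz (hβ : 0 ≤ β)
    (hg_lip : ∀ u v, ‖gradient g u - gradient g v‖ ≤ β * ‖u - v‖) : Continuous (gradient g) :=
  (LipschitzWith.of_dist_le_mul (K := ⟨β, hβ⟩) fun u v => by
    rw [dist_eq_norm, dist_eq_norm]; exact hg_lip u v).continuous

/-- Along the trajectory the residual is a subgradient of `f` at the proximal points. -/
theorem trajectory_subgradient (hf_bot : ∀ u, f u ≠ ⊥) (hf_convex : ConvexFun f) (hlam : 0 < lam)
    (hprox : ∀ t, 0 ≤ t → IsProx f lam (x t - lam • gradient g (x t)) (b t + γ • a t + x t))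
    {t : ℝ} (ht : 0 ≤ t) {u : V} (hu : f u ≠ ⊤) :
    (f (b t + γ • a t + x t)).toReal +
      inner ℝ (-(lam⁻¹ • (b t + γ • a t)) - gradient g (x t)) (u - (b t + γ • a t + x t))
      ≤ (f u).toReal := by
  have := (hprox t ht).subgradient_toReal hf_bot hf_convex hlam hu
  rwa [residual_eq hlam] at this

/-- Although `f` need not be continuous, subgradient inequalities at both times squeeze its value
along `y`, because the subgradients vary continuously. -/
theorem continuousOn_toReal_prox (hf_bot : ∀ u, f u ≠ ⊥) (hf_proper : ∃ u, f u ≠ ⊤)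
    (hf_convex : ConvexFun f) (hlam : 0 < lam) (hgc : Continuous (gradient g))
    (hxc : ContinuousOn x (Ici 0)) (hac : ContinuousOn a (Ici 0)) (hbc : ContinuousOn b (Ici 0))
    (hprox : ∀ t, 0 ≤ t → IsProx f lam (x t - lam • gradient g (x t)) (b t + γ • a t + x t)) :
    ContinuousOn (fun t => (f (b t + γ • a t + x t)).toReal) (Ici 0) := by
  intro t ht
  set y := fun t => b t + γ • a t + x t with hy
  set ξ := fun t => -(lam⁻¹ • (b t + γ • a t)) - gradient g (x t) with hξ
  have hyc : ContinuousOn y (Ici 0) := (hbc.add (hac.const_smul γ)).add hxc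
  have hξc : ContinuousOn ξ (Ici 0) :=
    ((hbc.add (hac.const_smul γ)).const_smul lam⁻¹).neg.sub (hgc.comp_continuousOn hxc)
  have hsub : ∀ s u, 0 ≤ s → 0 ≤ u →
      (f (y s)).toReal + inner ℝ (ξ s) (y u - y s) ≤ (f (y u)).toReal := fun s u hs hu =>
    trajectory_subgradient hf_bot hf_convex hlam hprox hs ((hprox u hu).ne_top hf_proper)
  have hyt : Tendsto (fun s => y s - y t) (𝓝[Ici 0] t) (𝓝 0) := by
    simpa using (hyc t ht).tendsto.sub_const (y t)
  have h1 : Tendsto (fun s => (f (y t)).toReal + inner ℝ (ξ t) (y s - y t)) (𝓝[Ici 0] t)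
      (𝓝 (f (y t)).toReal) := by
    simpa using ((tendsto_const_nhds (x := ξ t)).inner hyt).const_add (f (y t)).toReal
  have h2 : Tendsto (fun s => (f (y t)).toReal + inner ℝ (ξ s) (y s - y t)) (𝓝[Ici 0] t)
      (𝓝 (f (y t)).toReal) := by
    simpa using ((hξc t ht).tendsto.inner hyt).const_add (f (y t)).toReal
  refine tendsto_of_tendsto_of_tendsto_of_le_of_le' h1 h2 ?_ ?_
  · filter_upwards [self_mem_nhdsWithin] with s hs using hsub t s ht hs
  · filter_upwards [self_mem_nhdsWithin] with s hs
    have := hsub s t hs ht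
    rw [← neg_sub (y s), inner_neg_right] at this
    linarith

/-- Since `y` is a Lipschitz function of `x`, the difference quotients of `b` are bounded. A cluster
value `d` replaces the possibly missing derivative of `b`, and `energy_rate_le` holds for any such
`d`. -/
theorem energy_lowerRightDiniLE [ProperSpace V] (hf_bot : ∀ u, f u ≠ ⊥)
    (hf_proper : ∃ u, f u ≠ ⊤) (hf_convex : ConvexFun f) (hβ : 0 ≤ β)
    (hg_diff : Differentiable ℝ g)
    (hg_lip : ∀ u v, ‖gradient g u - gradient g v‖ ≤ β * ‖u - v‖) (hγ : 0 < γ) (hlam : 0 < lam)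
    (hx : ∀ t, 0 ≤ t → HasDerivWithinAt x (a t) (Ici 0) t)
    (ha : ∀ t, 0 ≤ t → HasDerivWithinAt a (b t) (Ici 0) t) (hbc : ContinuousOn b (Ici 0))
    (hprox : ∀ t, 0 ≤ t → IsProx f lam (x t - lam • gradient g (x t)) (b t + γ • a t + x t))
    {t : ℝ} (ht : 0 ≤ t) :
    LowerRightDiniLE (energy f g γ lam
      (γ * (constL γ lam β ^ 2 / (constL γ lam β ^ 2 + 1))) (constC γ lam β) x a b) t
      (constA γ lam β * ‖a t‖ ^ 2 + constB γ lam β * ‖b t‖ ^ 2) := by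
  intro r hr
  set κ := γ * (constL γ lam β ^ 2 / (constL γ lam β ^ 2 + 1)) with hκ
  set C := constC γ lam β with hC
  set y := fun t => b t + γ • a t + x t with hy
  set ξ := fun t => -(lam⁻¹ • (b t + γ • a t)) - gradient g (x t) with hξ
  have hgc := continuous_gradient_of_lipschitz hβ hg_lip
  have hxc : ContinuousOn x (Ici 0) := fun s hs => (hx s hs).continuousWithinAt
  have hac : ContinuousOn a (Ici 0) := fun s hs => (ha s hs).continuousWithinAt
  have hyc : ContinuousOn y (Ici 0) := (hbc.add (hac.const_smul γ)).add hxc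
  have hξc : ContinuousOn ξ (Ici 0) :=
    ((hbc.add (hac.const_smul γ)).const_smul lam⁻¹).neg.sub (hgc.comp_continuousOn hxc)
  have hsub : Ioi t ⊆ Ici 0 := fun s hs => ht.trans (le_of_lt hs)
  -- An ultrafilter finer than `𝓝[>] t` selects one limit of the bounded quotients by compactness of
  -- closed balls. A bound along it is only frequent for `𝓝[>] t`, which is what a lower derivative
  -- needs.
  set U : Ultrafilter ℝ := Ultrafilter.of (𝓝[>] t) with hU
  have hUle : (U : Filter ℝ) ≤ 𝓝[>] t := Ultrafilter.of_le _
  have hUle' : (U : Filter ℝ) ≤ 𝓝[Ici 0] t := hUle.trans (nhdsWithin_mono _ hsub)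
  have hUmem : ∀ᶠ z in (U : Filter ℝ), t < z := hUle self_mem_nhdsWithin
  have hsx : Tendsto (slope x t) U (𝓝 (a t)) :=
    ((hasDerivWithinAt_iff_tendsto_slope' self_notMem_Ioi).1 ((hx t ht).mono hsub)).mono_left hUle
  have hsa : Tendsto (slope a t) U (𝓝 (b t)) :=
    ((hasDerivWithinAt_iff_tendsto_slope' self_notMem_Ioi).1 ((ha t ht).mono hsub)).mono_left hUle
  have hslope_y : ∀ z, slope y t z = slope b t z + γ • slope a t z + slope x t z := fun z => by
    simp only [slope_def_module, hy]; module
  have hynorm : ∀ᶠ z in (U : Filter ℝ), ‖slope y t z‖ ≤ (1 + lam * β) * ‖slope x t z‖ := by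
    filter_upwards [hUmem] with z hz
    have hz0 : 0 < (z - t)⁻¹ := inv_pos.2 (sub_pos.2 hz)
    have := norm_prox_sub_le hf_bot hf_proper hf_convex hlam hg_lip
      (hprox z (ht.trans hz.le)) (hprox t ht)
    rw [slope_def_module, slope_def_module, norm_smul, norm_smul, Real.norm_of_nonneg hz0.le]
    have h2 := mul_le_mul_of_nonneg_left this hz0.le
    simp only [hy]
    linarith
  obtain ⟨d, hd⟩ : ∃ d, Tendsto (slope b t) U (𝓝 d) := by
    have hbd : ∀ᶠ z in (U : Filter ℝ), slope b t z ∈ Metric.closedBall (0 : V)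
        ((1 + lam * β) * (‖a t‖ + 1) + γ * (‖b t‖ + 1) + (‖a t‖ + 1)) := by
      filter_upwards [hynorm, hsx.norm.eventually_le_const (lt_add_one _),
        hsa.norm.eventually_le_const (lt_add_one _)] with z h1 h2 h3
      rw [mem_closedBall_zero_iff]
      have h4 : slope b t z = slope y t z - γ • slope a t z - slope x t z := by
        rw [hslope_y]; abel
      have h5 := norm_sub_le (slope y t z - γ • slope a t z) (slope x t z)
      have h6 := norm_sub_le (slope y t z) (γ • slope a t z)
      rw [norm_smul, Real.norm_of_nonneg hγ.le] at h6
      have h7 := mul_le_mul_of_nonneg_left h2 (show 0 ≤ 1 + lam * β by positivity)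
      have h8 := mul_le_mul_of_nonneg_left h3 hγ.le
      rw [h4]; linarith
    obtain ⟨d, -, hd⟩ := (isCompact_closedBall (0 : V) _).ultrafilter_le_nhds
      (U.map (slope b t)) (le_principal_iff.2 hbd)
    exact ⟨d, hd⟩
  have hsy : Tendsto (slope y t) U (𝓝 (d + γ • b t + a t)) := by
    simp only [funext hslope_y]
    exact (hd.add (hsa.const_smul γ)).add hsx
  have hY : ‖d + γ • b t + a t‖ ≤ (1 + lam * β) * ‖a t‖ :=
    le_of_tendsto_of_tendsto hsy.norm (hsx.norm.const_mul _) hynorm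
  have hgy : Tendsto (fun z => (z - t)⁻¹ • (g (y t + (y z - y t)) - g (y t))) U
      (𝓝 (inner ℝ (gradient g (y t)) (d + γ • b t + a t))) := by
    have h1 := (hg_diff (y t)).hasGradientAt.hasFDerivAt.hasFDerivWithinAt (s := univ)
    have h2 := h1.lim (l := (U : Filter ℝ)) (c := fun z => (z - t)⁻¹) (d := fun z => y z - y t)
      (v := d + γ • b t + a t)
      (by simpa using ((hyc t ht).tendsto.mono_left hUle').sub_const (y t))
      (Eventually.of_forall fun _ => mem_univ _) (hsy.congr fun z => slope_def_module _ _ _)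
    simpa using h2
  have hξt := (hξc t ht).tendsto.mono_left hUle'
  have hat := (hac t ht).tendsto.mono_left hUle'
  have hbt := (hbc t ht).tendsto.mono_left hUle'
  have hlim := (((hξt.inner hsy).add hgy).add
    ((((hbt.add (hat.const_smul κ)).add_const (b t + κ • a t)).inner
      (hd.add (hsa.const_smul κ))).const_mul (1 / (2 * lam)))).sub
    (((hat.add_const (a t)).inner hsa).const_mul (C / (2 * lam)))
  have hval := energy_rate_le hγ hlam hβ
    (show 1 ≤ constL γ lam β ^ 2 from one_le_pow₀ (one_le_constL hγ hlam hβ))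
    (norm_sq_add_norm_sq_le_constL hγ hlam hβ hY)
    (e := gradient g (y t) - gradient g (x t))
    (by simpa only [hy, add_sub_cancel_right] using hg_lip (y t) (x t))
  rw [← hκ] at hval
  have hlt := hlim.eventually_lt_const (u := r) (lt_of_le_of_lt (le_trans (le_of_eq ?_) hval) hr)
  · refine Frequently.filter_mono (Eventually.frequently ?_) hUle
    filter_upwards [hlt, hUmem] with z hz htz
    refine lt_of_le_of_lt ?_ hz
    have hz0 : 0 < (z - t)⁻¹ := inv_pos.2 (sub_pos.2 htz)
    -- The subgradient is taken at the later point `y z`, tested at `y t`: this bounds the forward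
    -- quotient of `f` along `y` from above.
    have h1 := trajectory_subgradient hf_bot hf_convex hlam hprox (ht.trans htz.le)
      ((hprox t ht).ne_top hf_proper)
    have hsq : ∀ p q : V, ‖p‖ ^ 2 - ‖q‖ ^ 2 = inner ℝ (p + q) (p - q) := fun p q => by
      simp only [inner_add_left, inner_sub_right, ← real_inner_self_eq_norm_sq,
        real_inner_comm q p]
      ring
    have h2 : (z - t)⁻¹ * ((f (y z)).toReal - (f (y t)).toReal) ≤
        inner ℝ (ξ z) (slope y t z) := by
      rw [slope_def_module, real_inner_smul_right]
      refine mul_le_mul_of_nonneg_left ?_ hz0.le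
      rw [← neg_sub (y z) (y t), inner_neg_right] at h1
      linarith
    have h3 : slope b t z + κ • slope a t z =
        (z - t)⁻¹ • (b z + κ • a z - (b t + κ • a t)) := by
      simp only [slope_def_module]; module
    rw [h3, slope_def_module a, real_inner_smul_right, real_inner_smul_right, ← hsq, ← hsq,
      add_sub_cancel, slope_def_field, div_eq_inv_mul, smul_eq_mul]
    simp only [energy]
    have h4 : (z - t)⁻¹ * ((f (y z)).toReal + g (y z) +
        (1 / (2 * lam) * ‖b z + κ • a z‖ ^ 2 - C / (2 * lam) * ‖a z‖ ^ 2) -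
        ((f (y t)).toReal + g (y t) +
        (1 / (2 * lam) * ‖b t + κ • a t‖ ^ 2 - C / (2 * lam) * ‖a t‖ ^ 2))) =
        (z - t)⁻¹ * ((f (y z)).toReal - (f (y t)).toReal) + (z - t)⁻¹ * (g (y z) - g (y t)) +
        1 / (2 * lam) * ((z - t)⁻¹ * (‖b z + κ • a z‖ ^ 2 - ‖b t + κ • a t‖ ^ 2)) -
        C / (2 * lam) * ((z - t)⁻¹ * (‖a z‖ ^ 2 - ‖a t‖ ^ 2)) := by ring
    simp only [hy] at h4 h2 ⊢
    rw [h4]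
    linarith
  · have h5 : -(lam⁻¹ • (b t + γ • a t)) + (gradient g (y t) - gradient g (x t))
        = ξ t + gradient g (y t) := by simp only [hξ]; abel
    rw [h5, inner_add_left (ξ t), hC, constC, ← two_smul ℝ (b t + κ • a t), ← two_smul ℝ (a t),
      real_inner_smul_left, real_inner_smul_left]
    field_simp

/-- Since `y` is Lipschitz in `x`, it is Cauchy, so `b + γ a` converges. Damping makes `a` converge,
necessarily to zero because `x` does; then `b` vanishes too. -/
theorem trajectory_limits (hf_bot : ∀ u, f u ≠ ⊥) (hf_proper : ∃ u, f u ≠ ⊤)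
    (hf_convex : ConvexFun f) (hβ : 0 ≤ β)
    (hg_lip : ∀ u v, ‖gradient g u - gradient g v‖ ≤ β * ‖u - v‖) (hγ : 0 < γ) (hlam : 0 < lam)
    (hx : ∀ t, 0 ≤ t → HasDerivWithinAt x (a t) (Ici 0) t)
    (ha : ∀ t, 0 ≤ t → HasDerivWithinAt a (b t) (Ici 0) t)
    (hprox : ∀ t, 0 ≤ t → IsProx f lam (x t - lam • gradient g (x t)) (b t + γ • a t + x t))
    {xbar : V} (hlim : Tendsto x atTop (𝓝 xbar)) :
    Tendsto a atTop (𝓝 0) ∧ Tendsto b atTop (𝓝 0) := by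
  set y := fun t => b t + γ • a t + x t with hy
  have hlb : 0 < 1 + lam * β := by positivity
  have hcauchy : Cauchy (map y atTop) := by
    rw [Metric.cauchy_iff]
    refine ⟨inferInstance, fun ε hε => ?_⟩
    obtain ⟨T, hT⟩ := eventually_atTop.1 ((Metric.tendsto_nhds.1 hlim
      (ε / (2 * (1 + lam * β))) (by positivity)).and (eventually_ge_atTop 0))
    refine ⟨y '' Ici T, image_mem_map (Ici_mem_atTop T), ?_⟩
    rintro _ ⟨s, hs, rfl⟩ _ ⟨u, hu, rfl⟩
    have h1 := norm_prox_sub_le hf_bot hf_proper hf_convex hlam hg_lip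
      (hprox s (hT s hs).2) (hprox u (hT u hu).2)
    have h2 := dist_triangle_right (x s) (x u) xbar
    have h3 := (hT s hs).1
    have h4 := (hT u hu).1
    rw [dist_eq_norm (x s) (x u)] at h2
    rw [dist_eq_norm]
    have h5 : (1 + lam * β) * ‖x s - x u‖ <
        (1 + lam * β) * (ε / (2 * (1 + lam * β)) + ε / (2 * (1 + lam * β))) :=
      mul_lt_mul_of_pos_left (by linarith) hlb
    have h6 : (1 + lam * β) * (ε / (2 * (1 + lam * β)) + ε / (2 * (1 + lam * β))) = ε := by
      field_simp; ring
    simp only [hy]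
    linarith
  obtain ⟨ybar, hybar⟩ := cauchy_map_iff_exists_tendsto.1 hcauchy
  have hba : Tendsto (fun t => b t + γ • a t) atTop (𝓝 (ybar - xbar)) := by
    simpa [hy] using Tendsto.sub hybar hlim
  set c := γ⁻¹ • (ybar - xbar) with hc
  have hac : Tendsto (fun t => a t - c) atTop (𝓝 0) := by
    refine tendsto_zero_of_damped hγ
      (fun t ht => ((ha t ht).mono fun u hu => ht.trans hu).sub_const c)
      ((show ContinuousOn a (Ici 0) from fun s hs => (ha s hs).continuousWithinAt).sub
        continuousOn_const) ?_
    have h1 : ∀ t, b t + γ • (a t - c) = b t + γ • a t - (ybar - xbar) := fun t => by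
      rw [smul_sub, hc, smul_smul, mul_inv_cancel₀ hγ.ne', one_smul]; abel
    simp only [h1]
    simpa using hba.sub_const (ybar - xbar)
  have hac' : Tendsto a atTop (𝓝 c) := by simpa using hac.add_const c
  have hc0 : c = 0 := eq_zero_of_tendsto_of_deriv_tendsto hx hlim hac'
  rw [hc0] at hac'
  have hyx : ybar - xbar = 0 := by
    rw [hc] at hc0
    exact (smul_eq_zero.1 hc0).resolve_left (inv_ne_zero hγ.ne')
  refine ⟨hac', ?_⟩
  rw [hyx] at hba
  simpa using hba.sub (hac'.const_smul γ)

/-- Lower semicontinuity bounds `f` along `y` from below; the subgradient inequality tested at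
`xbar` bounds it from above. -/
theorem tendsto_energy (hf_bot : ∀ u, f u ≠ ⊥)
    (hf_proper : ∃ u, f u ≠ ⊤) (hf_convex : ConvexFun f) (hf_lsc : LowerSemicontinuous f)
    (hg : Continuous g) (hgc : Continuous (gradient g)) (hlam : 0 < lam) (κ C : ℝ)
    (hprox : ∀ t, 0 ≤ t → IsProx f lam (x t - lam • gradient g (x t)) (b t + γ • a t + x t))
    {xbar : V} (hlim : Tendsto x atTop (𝓝 xbar)) (halim : Tendsto a atTop (𝓝 0))
    (hblim : Tendsto b atTop (𝓝 0)) (hfx : f xbar ≠ ⊤) :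
    Tendsto (energy f g γ lam κ C x a b) atTop (𝓝 ((f xbar).toReal + g xbar)) := by
  have hba : Tendsto (fun t => b t + γ • a t) atTop (𝓝 0) := by
    simpa using hblim.add (halim.const_smul γ)
  have hbκ : Tendsto (fun t => b t + κ • a t) atTop (𝓝 0) := by
    simpa using hblim.add (halim.const_smul κ)
  have hy : Tendsto (fun t => b t + γ • a t + x t) atTop (𝓝 xbar) := by
    simpa using hba.add hlim
  have hf : Tendsto (fun t => (f (b t + γ • a t + x t)).toReal) atTop (𝓝 (f xbar).toReal) := by
    have hup : Tendsto (fun t => (f xbar).toReal -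
        inner ℝ (-(lam⁻¹ • (b t + γ • a t)) - gradient g (x t)) (xbar - (b t + γ • a t + x t)))
        atTop (𝓝 (f xbar).toReal) := by
      simpa using ((((hba.const_smul lam⁻¹).neg.sub ((hgc.tendsto xbar).comp hlim)).inner
        (hy.const_sub xbar)).const_sub (f xbar).toReal)
    rw [tendsto_order]
    constructor
    · intro r hr
      have hr' : (r : EReal) < f xbar := by
        rw [← EReal.coe_toReal hfx (hf_bot xbar)]; exact_mod_cast hr
      filter_upwards [hy.eventually (hf_lsc xbar r hr'), eventually_ge_atTop 0] with t h1 h2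
      rw [← EReal.coe_toReal ((hprox t h2).ne_top hf_proper) (hf_bot _)] at h1
      exact_mod_cast h1
    · intro r hr
      filter_upwards [hup.eventually_lt_const hr, eventually_ge_atTop 0] with t h1 h2
      have := trajectory_subgradient hf_bot hf_convex hlam hprox h2 hfx
      linarith
  have := (hf.add ((hg.tendsto xbar).comp hy)).add
    (((hbκ.norm.pow 2).const_mul (1 / (2 * lam))).sub ((halim.norm.pow 2).const_mul (C / (2 * lam))))
  unfold energy
  simpa using this

end Trajectory

/-! ### The regularization along the trajectory -/

theorem tendsto_triple {V : Type*} [NormedAddCommGroup V] {u v w : ℝ → V} {u₀ v₀ w₀ : V} {l : Filter ℝ}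
    (hu : Tendsto u l (𝓝 u₀))
    (hv : Tendsto v l (𝓝 v₀)) (hw : Tendsto w l (𝓝 w₀)) :
    Tendsto (fun t => triple (u t) (v t) (w t)) l (𝓝 (triple u₀ v₀ w₀)) := by
  refine ((PiLp.continuous_toLp 2 _).tendsto _).comp (tendsto_pi_nhds.2 fun i => ?_)
  fin_cases i <;> simpa

theorem ne_top_of_mem_crit_objective {V : Type*} [NormedAddCommGroup V] [InnerProductSpace ℝ V]
    {f : V → EReal} {g : V → ℝ} {xbar : V} (h : xbar ∈ crit (objective f g)) :
    f xbar ≠ ⊤ := by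
  intro hf
  apply h.1
  rw [objective, hf, EReal.top_add_coe]

theorem exists_dissipation_constant {A B : ℝ} (hA : A < 0) (hB : B < 0) :
    ∃ c : ℝ, 0 < c ∧ ∀ p q : ℝ, A * p ^ 2 + B * q ^ 2 ≤ -(c * (p + q) ^ 2) := by
  refine ⟨min (-A) (-B) / 2, by have := lt_min (neg_pos.2 hA) (neg_pos.2 hB); positivity,
    fun p q => ?_⟩
  have h1 := mul_le_mul_of_nonneg_right (min_le_left (-A) (-B)) (sq_nonneg p)
  have h2 := mul_le_mul_of_nonneg_right (min_le_right (-A) (-B)) (sq_nonneg q)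
  have h3 : 0 ≤ min (-A) (-B) * (p - q) ^ 2 :=
    mul_nonneg (lt_min (neg_pos.2 hA) (neg_pos.2 hB)).le (sq_nonneg _)
  nlinarith

section Regularization

variable {V : Type*} [NormedAddCommGroup V] [InnerProductSpace ℝ V]
  {f : V → EReal} {g : V → ℝ} {γ lam β : ℝ} {x a b : ℝ → V}

theorem toReal_regularization_eq_energy {t : ℝ} (κ C : ℝ) (hbot : f (b t + γ • a t + x t) ≠ ⊥)
    (htop : f (b t + γ • a t + x t) ≠ ⊤) :
    (regularization f g lam C (triple (b t + γ • a t + x t)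
      (b t + γ • a t + x t - (b t + κ • a t)) (a t))).toReal = energy f g γ lam κ C x a b t := by
  have h : ∀ u v w : V, regularization f g lam C (triple u v w) = f u + (g u : EReal) +
      ((1 / (2 * lam) * ‖u - v‖ ^ 2 - C / (2 * lam) * ‖w‖ ^ 2 : ℝ) : EReal) := fun _ _ _ => rfl
  rw [h, sub_sub_cancel, ← EReal.coe_toReal htop hbot, ← EReal.coe_add, ← EReal.coe_add,
    EReal.toReal_coe, energy]

theorem toReal_regularization_diagonal {xbar : V} (C : ℝ) (hbot : f xbar ≠ ⊥)
    (htop : f xbar ≠ ⊤) :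
    (regularization f g lam C (triple xbar xbar 0)).toReal = (f xbar).toReal + g xbar := by
  have := toReal_regularization_eq_energy (f := f) (g := g) (γ := 0) (lam := lam) (x := fun _ => xbar)
    (a := fun _ => 0) (b := fun _ => 0) (t := 0) 0 C (by simpa using hbot) (by simpa using htop)
  simpa [energy] using this

variable [CompleteSpace V]

/-- The Łojasiewicz inequality of the regularization along the trajectory. -/
theorem exists_lojasiewicz_along_trajectory (hf_bot : ∀ u, f u ≠ ⊥) (hf_proper : ∃ u, f u ≠ ⊤)
    (hf_convex : ConvexFun f) (hβ : 0 ≤ β) (hg_diff : Differentiable ℝ g)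
    (hg_lip : ∀ u v, ‖gradient g u - gradient g v‖ ≤ β * ‖u - v‖) (hγ : 0 < γ) (hlam : 0 < lam)
    (hprox : ∀ t, 0 ≤ t → IsProx f lam (x t - lam • gradient g (x t)) (b t + γ • a t + x t))
    {xbar : V} (hlim : Tendsto x atTop (𝓝 xbar)) (halim : Tendsto a atTop (𝓝 0))
    (hblim : Tendsto b atTop (𝓝 0)) (hfx : f xbar ≠ ⊤) (κ C : ℝ) {θ : ℝ}
    (hH : HasLojasiewiczExponentAt (regularization f g lam C) (triple xbar xbar 0) θ) :
    ∃ T K : ℝ, 0 ≤ T ∧ 0 < K ∧ ∀ t, T ≤ t →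
      |energy f g γ lam κ C x a b t - ((f xbar).toReal + g xbar)| ^ θ ≤
        K * (‖a t‖ + ‖b t‖) := by
  obtain ⟨-, -, -, K, ε, hK, hε, hloj⟩ := hH
  have hy : Tendsto (fun t => b t + γ • a t + x t) atTop (𝓝 xbar) := by
    simpa using (hblim.add (halim.const_smul γ)).add hlim
  have hv : Tendsto (fun t => b t + γ • a t + x t - (b t + κ • a t)) atTop (𝓝 xbar) := by
    simpa using hy.sub (hblim.add (halim.const_smul κ))
  obtain ⟨T, hT⟩ := eventually_atTop.1
    ((Metric.tendsto_nhds.1 (tendsto_triple hy hv halim) ε hε).and (eventually_ge_atTop 0))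
  -- Sum of the coefficients in the bounds for the three subgradient components; the final `1`
  -- ensures positivity.
  set M := β * (1 + γ) + lam⁻¹ * (|κ| + γ) + lam⁻¹ * (1 + |κ|) + |C / lam| + 1 with hM
  have hM0 : 0 < M := by positivity
  refine ⟨T, K * M, (hT T le_rfl).2, by positivity, fun t ht => ?_⟩
  obtain ⟨hdist, ht0⟩ := hT t ht
  have htop := (hprox t ht0).ne_top hf_proper
  have hmem := mem_limitingSubdiff_regularization (f := f) (g := g) (C := C)
    (v := b t + γ • a t + x t - (b t + κ • a t)) (w := a t) hlam.ne' hg_diff htop (hf_bot _)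
    (ξ := -(lam⁻¹ • (b t + γ • a t)) - gradient g (x t)) (fun u => by
      have := (hprox t ht0).subgradient hf_bot hf_proper hf_convex hlam u
      rwa [residual_eq hlam] at this)
  have h1 := hloj _ (by rwa [← dist_eq_norm]) _ hmem
  rw [toReal_regularization_eq_energy κ C (hf_bot _) htop,
    toReal_regularization_diagonal C (hf_bot _) hfx] at h1
  refine h1.trans ?_
  rw [mul_assoc]
  refine mul_le_mul_of_nonneg_left ((norm_triple_le _ _ _).trans ?_) hK.le
  have ha0 := norm_nonneg (a t)
  have hb0 := norm_nonneg (b t)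
  have hli : 0 ≤ lam⁻¹ := (inv_pos.2 hlam).le
  have hba : ∀ μ : ℝ, ‖b t + μ • a t‖ ≤ ‖b t‖ + |μ| * ‖a t‖ := fun μ => by
    have := norm_add_le (b t) (μ • a t)
    rwa [norm_smul, Real.norm_eq_abs] at this
  -- The residual and the quadratic coupling cancel in `b`, leaving a gradient difference,
  -- controlled by the Lipschitz bound, and a multiple of `a`.
  have e1 : -(lam⁻¹ • (b t + γ • a t)) - gradient g (x t) + gradient g (b t + γ • a t + x t) +
      lam⁻¹ • (b t + γ • a t + x t - (b t + γ • a t + x t - (b t + κ • a t))) =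
      (gradient g (b t + γ • a t + x t) - gradient g (x t)) + (lam⁻¹ * (κ - γ)) • a t := by
    module
  have e2 : b t + γ • a t + x t - (b t + κ • a t) - (b t + γ • a t + x t) =
      -(b t + κ • a t) := by abel
  have n1 : ‖gradient g (b t + γ • a t + x t) - gradient g (x t) + (lam⁻¹ * (κ - γ)) • a t‖ ≤
      β * (‖b t‖ + γ * ‖a t‖) + lam⁻¹ * (|κ| + γ) * ‖a t‖ := by
    refine (norm_add_le _ _).trans (add_le_add ?_ ?_)
    · refine (hg_lip _ _).trans (mul_le_mul_of_nonneg_left ?_ hβ)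
      rw [add_sub_cancel_right]
      simpa [abs_of_pos hγ] using hba γ
    · rw [norm_smul, Real.norm_eq_abs, abs_mul, abs_of_nonneg hli]
      have := abs_sub κ γ
      rw [abs_of_pos hγ] at this
      gcongr
  have n2 : ‖lam⁻¹ • -(b t + κ • a t)‖ ≤ lam⁻¹ * (‖b t‖ + |κ| * ‖a t‖) := by
    rw [norm_smul, norm_neg, Real.norm_of_nonneg hli]
    exact mul_le_mul_of_nonneg_left (hba κ) hli
  have n3 : ‖-(C / lam) • a t‖ = |C / lam| * ‖a t‖ := by
    rw [norm_smul, Real.norm_eq_abs, abs_neg]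
  rw [e1, e2, n3]
  refine (add_le_add (add_le_add n1 n2) le_rfl).trans ?_
  have p1 : 0 ≤ β * ‖a t‖ := by positivity
  have p2 : 0 ≤ β * γ * ‖b t‖ := by positivity
  have p3 : 0 ≤ lam⁻¹ * ‖a t‖ := by positivity
  have p4 : 0 ≤ lam⁻¹ * (|κ| + γ) * ‖b t‖ := by positivity
  have p5 : 0 ≤ lam⁻¹ * |κ| * ‖b t‖ := by positivity
  have p6 : 0 ≤ |C / lam| * ‖b t‖ := by positivity
  rw [hM]
  nlinarith

theorem continuousOn_energy (hf_bot : ∀ u, f u ≠ ⊥) (hf_proper : ∃ u, f u ≠ ⊤)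
    (hf_convex : ConvexFun f) (hlam : 0 < lam) (hg : Continuous g) (hgc : Continuous (gradient g))
    (hxc : ContinuousOn x (Ici 0)) (hac : ContinuousOn a (Ici 0)) (hbc : ContinuousOn b (Ici 0))
    (hprox : ∀ t, 0 ≤ t → IsProx f lam (x t - lam • gradient g (x t)) (b t + γ • a t + x t))
    (κ C : ℝ) : ContinuousOn (energy f g γ lam κ C x a b) (Ici 0) :=
  ((continuousOn_toReal_prox hf_bot hf_proper hf_convex hlam hgc hxc hac hbc hprox).add
    (hg.comp_continuousOn ((hbc.add (hac.const_smul γ)).add hxc))).add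
    ((continuousOn_const.mul ((hbc.add (hac.const_smul κ)).norm.pow 2)).sub
      (continuousOn_const.mul (hac.norm.pow 2)))

end Regularization

end ProxGrad
-- The convergence rates for the proximal-gradient dynamics
open ProxGrad in
theorem theorem5 (n : ℕ)
    (f : EuclideanSpace ℝ (Fin n) → EReal) (g : EuclideanSpace ℝ (Fin n) → ℝ)
    (hf_bot : ∀ u, f u ≠ ⊥) (hf_proper : ∃ u, f u ≠ ⊤)
    (hf_convex : ConvexFun f) (hf_lsc : LowerSemicontinuous f)
    (β : ℝ) (hβ : 0 ≤ β) (hg_diff : Differentiable ℝ g)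
    (hg_lip : ∀ u v, ‖gradient g u - gradient g v‖ ≤ β * ‖u - v‖)
    (hfg_bdd : ∃ m : ℝ, ∀ u, (m : EReal) ≤ objective f g u)
    (γ lam : ℝ) (hγ : 0 < γ) (hlam : 0 < lam)
    (hA : constA γ lam β < 0) (hB : constB γ lam β < 0) (hC : constC γ lam β < 0)
    (u₀ v₀ : EuclideanSpace ℝ (Fin n)) (x : ℝ → EuclideanSpace ℝ (Fin n))
    (hx : IsSolution f g γ lam u₀ v₀ x)
    (hx_bdd : Bornology.IsBounded (x '' Ici 0))
    (xbar : EuclideanSpace ℝ (Fin n)) (hxbar : xbar ∈ crit (objective f g))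
    (hx_lim : Tendsto x atTop (𝓝 xbar))
    (θ : ℝ)
    (hH : HasLojasiewiczExponentAt (regularization f g lam (constC γ lam β))
      (triple xbar xbar 0) θ) :
    ∃ a₁ a₂ a₃ a₄ t₀ : ℝ, 0 < a₁ ∧ 0 < a₂ ∧ 0 < a₃ ∧ 0 < a₄ ∧ 0 < t₀ ∧
      ∀ t : ℝ, t₀ ≤ t →
        (θ < 1 / 2 → x t = xbar) ∧
        (θ = 1 / 2 →
          ‖x t - xbar‖ ≤ a₁ * Real.exp (-a₂ * t) ∧
          ‖velocity x t‖ ≤ a₁ * Real.exp (-a₂ * t)) ∧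
        (1 / 2 < θ →
          ‖x t - xbar‖ ≤ (a₃ * t + a₄) ^ (-((1 - θ) / (2 * θ - 1))) ∧
          ‖velocity x t‖ ≤ (a₃ * t + a₄) ^ (-((1 - θ) / (2 * θ - 1)))) := by
  have hgc := continuous_gradient_of_lipschitz hβ hg_lip
  have hud : UniqueDiffOn ℝ (Ici (0 : ℝ)) := uniqueDiffOn_Ici 0
  have hv1 : ContDiffOn ℝ 1 (velocity x) (Ici 0) :=
    hx.contDiffOn.derivWithin hud (by norm_num)
  have hbc : ContinuousOn (acceleration x) (Ici 0) :=
    (hv1.derivWithin (m := 0) hud (by norm_num)).continuousOn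
  have hdx : ∀ t, 0 ≤ t → HasDerivWithinAt x (velocity x t) (Ici 0) t := fun t ht =>
    ((hx.contDiffOn.differentiableOn (by norm_num)) t ht).hasDerivWithinAt
  have hda : ∀ t, 0 ≤ t → HasDerivWithinAt (velocity x) (acceleration x t) (Ici 0) t :=
    fun t ht => ((hv1.differentiableOn (by norm_num)) t ht).hasDerivWithinAt
  have hprox := hx.prox_eq
  have hfx := ne_top_of_mem_crit_objective hxbar
  obtain ⟨halim, hblim⟩ := trajectory_limits hf_bot hf_proper hf_convex hβ hg_lip hγ hlam hdx hda
    hprox hx_lim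
  set κ := γ * (constL γ lam β ^ 2 / (constL γ lam β ^ 2 + 1)) with hκ
  obtain ⟨T, K, hT0, hK, hloj⟩ := exists_lojasiewicz_along_trajectory hf_bot hf_proper hf_convex hβ
    hg_diff hg_lip hγ hlam hprox hx_lim halim hblim hfx κ (constC γ lam β) hH
  obtain ⟨c, hc, hdiss⟩ := exists_dissipation_constant hA hB
  have hsub : Ici T ⊆ Ici 0 := Ici_subset_Ici.2 hT0
  have hec := continuousOn_energy hf_bot hf_proper hf_convex hlam hg_diff.continuous hgc
    hx.contDiffOn.continuousOn hv1.continuousOn hbc hprox κ (constC γ lam β)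
  have he := tendsto_energy hf_bot hf_proper hf_convex hf_lsc hg_diff.continuous hgc hlam κ
    (constC γ lam β) hprox hx_lim halim hblim hfx
  refine convergence_rates_of_lojasiewicz hc hK hH.2.1 hH.2.2.1
    (e := fun t => energy f g γ lam κ (constC γ lam β) x (velocity x) (acceleration x) t -
      ((f xbar).toReal + g xbar)) ((hec.mono hsub).sub continuousOn_const)
    (by simpa using he.sub_const ((f xbar).toReal + g xbar))
    (hx.contDiffOn.continuousOn.mono hsub) (hv1.continuousOn.mono hsub)
    (fun t ht => (hdx t (hT0.trans ht)).mono (Ici_subset_Ici.2 (hT0.trans ht)))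
    (fun t ht => (hda t (hT0.trans ht)).mono (Ici_subset_Ici.2 (hT0.trans ht)))
    hx_lim halim (fun t ht => ?_) hloj
  exact ((energy_lowerRightDiniLE hf_bot hf_proper hf_convex hβ hg_diff hg_lip hγ hlam hdx hda hbc
    hprox (hT0.trans ht)).mono (hdiss _ _)).sub_const _
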